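/- Let $X,Y,Z$ be the one-qubit Pauli matrices, $H=\frac1{\sqrt2}\begin{bmatrix}1&1\\1&-1\end{bmatrix}$, $S=\mathrm{diag}(1,i)$, $CZ=\mathrm{diag}(1,1,1,-1)$, $CS=\mathrm{diag}(1,1,1,i)$. Let $\mathcal C\subset U(4)$ be the group generated by $H\otimes I$, $I\otimes H$, $S\otimes I$, $I\otimes S$, $CZ$ (the two-qubit Clifford group) and $\mathcal G_{CS}\supset\mathcal C$ the group generated by $\mathcal C$ and $CS$ (the Clifford+$CS$ group). For commuting Hermitian Paulis $P,Q$ put $R(P,Q)=\exp\left(\frac{i\pi}{2}\cdot\frac{I-P}{2}\cdot\frac{I-Q}{2}\right)$, and let $\mathcal S=\{\mathcal S_1,\dots,\mathcal S_{15}\}$ be the list of generators \[ \begin{aligned} &R(X\otimes I,I\otimes X),\ R(Y\otimes I,I\otimes Y),\ R(Z\otimes I,I\otimes Z),\ R(Y\otimes I,I\otimes Z),\ R(Z\otimes I,I\otimes Y),\\ &R(Z\otimes I,I\otimes X),\ R(X\otimes I,I\otimes Z),\ R(X\otimes I,I\otimes Y),\ R(Y\otimes I,I\otimes X),\ R(X\otimes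 X,Y\otimes Y),\\ &R(X\otimes X,Z\otimes Y),\ R(Z\otimes X,Y\otimes Y),\ R(Y\otimes X,X\otimes Y),\ R(Z\otimes X,X\otimes Y),\ R(Y\otimes X,Z\otimes Y), \end{aligned} \] in this order. For $U\in U(4)$ let $\overline U\in SO(6)$ be the matrix $\overline U_{jk}=\langle B_j,\textstyle\bigwedge^2(\lambda U)\,B_k\rangle$, where $\lambda^4\det U=1$ (the choice of $\lambda$ matters only up to a global sign of $\overline U$) and $B$ is the ordered orthonormal basis \[ \tfrac{i}{\sqrt2}(e_{12}-e_{34}),\ \tfrac1{\sqrt2}(e_{12}+e_{34}),\ \tfrac{i}{\sqrt2}(e_{23}-e_{14}),\ \tfrac1{\sqrt2}(e_{24}+e_{31}),\ \tfrac{i}{\sqrt2}(e_{24}-e_{31}),\ \tfrac1{\sqrt2}(e_{23}+e_{14}) \] of $\bigwedge^2\mathbb C^4$, with $e_{ab}=e_a\wedge e_b$. For a matrix $V$ such that $\sqrt2^{\,\ell}V$ is an integer matrix for some $\ell\in\mathbb N$, the least such $\ell$ is denoted $\mathrm{lde}(V)$, and the pattern $\mathrm{p}(V)$ is the partition of $\{1,\dots,6\}$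 in which two indices are in the same block if and only if the corresponding rows of $\sqrt2^{\,\mathrm{lde}(V)}V$ agree modulo $2$. The synthesis algorithm takes $U\in\mathcal G_{CS}$ as input. If $\mathrm{lde}(\overline U)=0$, it outputs the one-letter word $U$. If $\mathrm{lde}(\overline U)=k>0$, it takes the $R\in\mathcal S$ of lowest index with $\mathrm{lde}(\overline R^{\mathsf T}\,\overline U)=k-1$, outputs the letter $R$, and continues with $R^\dagger U$. The output is the normal form of $U$; let $\mathcal N$ be the set of the normal forms of all $U\in\mathcal G_{CS}$. All automata below have the alphabet $\mathcal S\cup\mathcal C$. For $1\le n\le m\le 15$ let $\mathfrak S_{n,m}$ be the automaton with states $1,\dots,m$, initial states $n,\dots,m$, all states final, and a transition from $s$ to $t$ labelled $\mathcal S_s$ whenever $\mathrm p(\overline{\mathcal S_s})\cap \mathrm p(\overline{\mathcal S_t})=\varnothing$ (no common block), and no other transitions. Let $\mathfrak C$ be the automaton with one initial state, one final state for each $C\in\mathcal C$, and exactly one transition, labelled $C$, from the initial state to the final state of $C$. The concatenation $A\circ A'$ is the disjoint union of $A$ and $A'$ with an added $\varepsilon$-transition from each final state of $A$ to each initial state of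 $A'$, with the initial states of $A$ and the final states of $A'$. **Theorem.** Every normal form is a word over $\mathcal S\cup\mathcal C$, and a word over $\mathcal S\cup\mathcal C$ belongs to $\mathcal N$ if and only if it is accepted by the automaton $\mathfrak S_{1,3}\circ\mathfrak S_{4,9}\circ\mathfrak S_{10,15}\circ\mathfrak C$. -/

import Mathlib

open scoped Matrix Kronecker

noncomputable section

namespace CliffordCS

/-! ### Two-qubit operators -/

/-- Operators on one qubit. -/
abbrev Mat2 := Matrix (Fin 2) (Fin 2) ℂ

/-- Operators on two qubits, in the computational basis `00, 01, 10, 11`. -/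
abbrev Mat4 := Matrix (Fin 4) (Fin 4) ℂ

/-- The tensor product of two one-qubit operators, as a `4 × 4` matrix. -/
def tensor (A B : Mat2) : Mat4 :=
  Matrix.reindex finProdFinEquiv finProdFinEquiv (A ⊗ₖ B)

/-- The Pauli gate `X`. -/
def X : Mat2 := !![0, 1; 1, 0]

/-- The Pauli gate `Y`. -/
def Y : Mat2 := !![0, -Complex.I; Complex.I, 0]

/-- The Pauli gate `Z`. -/
def Z : Mat2 := !![1, 0; 0, -1]

/-- The Hadamard gate. -/
def H : Mat2 := ((1 / Real.sqrt 2 : ℝ) : ℂ) • !![1, 1; 1, -1]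

/-- The phase gate. -/
def S : Mat2 := !![1, 0; 0, Complex.I]

/-- The controlled-`Z` gate. -/
def CZ : Mat4 := Matrix.diagonal ![1, 1, 1, -1]

/-- The controlled-phase gate. -/
def CS : Mat4 := Matrix.diagonal ![1, 1, 1, Complex.I]

/-- The two-qubit Clifford gates. -/
def cliffordGates : Set Mat4 :=
  {tensor H 1, tensor 1 H, tensor S 1, tensor 1 S, CZ}

/-- The two-qubit Clifford group: all operators given by circuits, i.e. finite products, of
Clifford gates. Every gate has finite order, so this is also the group that they generate. -/
def clifford : Submonoid Mat4 := Submonoid.closure cliffordGates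

/-- The two-qubit Clifford+`CS` group: all operators given by circuits of Clifford gates and `CS`
gates. Every gate has finite order, so this is also the group that they generate. -/
def cliffordCS : Submonoid Mat4 := Submonoid.closure (insert CS cliffordGates)

/-- `R(P,Q) = exp (iπ/2 · (1-P)/2 · (1-Q)/2)`. -/
def R (P Q : Mat4) : Mat4 :=
  NormedSpace.exp ((Complex.I * Real.pi / 2) •
    (((1 / 2 : ℂ) • (1 - P)) * ((1 / 2 : ℂ) • (1 - Q))))

/-- The fifteen generators in their fixed order; `gen j` is the generator of index `j + 1`. -/
def gen : Fin 15 → Mat4 :=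
  ![R (tensor X 1) (tensor 1 X), R (tensor Y 1) (tensor 1 Y), R (tensor Z 1) (tensor 1 Z),
    R (tensor Y 1) (tensor 1 Z), R (tensor Z 1) (tensor 1 Y), R (tensor Z 1) (tensor 1 X),
    R (tensor X 1) (tensor 1 Z), R (tensor X 1) (tensor 1 Y), R (tensor Y 1) (tensor 1 X),
    R (tensor X X) (tensor Y Y), R (tensor X X) (tensor Z Y), R (tensor Z X) (tensor Y Y),
    R (tensor Y X) (tensor X Y), R (tensor Z X) (tensor X Y), R (tensor Y X) (tensor Z Y)]

/-- The alphabet: the generators together with the Clifford operators. -/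
def alphabet : Set Mat4 := Set.range gen ∪ (clifford : Set Mat4)

/-! ### The representation by orthogonal `6 × 6` matrices

The space `⋀² ℂ⁴` is realised as the space of skew-symmetric `4 × 4` matrices, with
`v ∧ w = v wᵀ - w vᵀ`. The lemmas `wedgeInner_wedge` and `wedgeAct_wedge` identify the inner product
and the action of an operator. -/

/-- The wedge product of two vectors of `ℂ⁴`. -/
def wedge (v w : Fin 4 → ℂ) : Mat4 := Matrix.vecMulVec v w - Matrix.vecMulVec w v

/-- The inner product on `⋀² ℂ⁴`, conjugate-linear in the first argument. -/
def wedgeInner (x y : Mat4) : ℂ := (1 / 2) * ∑ a, ∑ b, star (x a b) * y a b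

/-- The action of an operator `U` on `⋀² ℂ⁴`. -/
def wedgeAct (U x : Mat4) : Mat4 := U * x * Uᵀ

theorem wedgeInner_wedge (v₁ v₂ w₁ w₂ : Fin 4 → ℂ) :
    wedgeInner (wedge v₁ v₂) (wedge w₁ w₂) =
      Matrix.det !![star v₁ ⬝ᵥ w₁, star v₁ ⬝ᵥ w₂; star v₂ ⬝ᵥ w₁, star v₂ ⬝ᵥ w₂] := by
  simp only [wedgeInner, wedge, Matrix.sub_apply, Matrix.vecMulVec_apply, Matrix.det_fin_two_of,
    dotProduct, Fin.sum_univ_four, Pi.star_apply, star_sub, star_mul']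
  ring

theorem wedgeAct_wedge (U : Mat4) (v w : Fin 4 → ℂ) :
    wedgeAct U (wedge v w) = wedge (U *ᵥ v) (U *ᵥ w) := by
  simp only [wedgeAct, wedge, Matrix.mul_sub, Matrix.sub_mul, Matrix.mul_vecMulVec,
    Matrix.vecMulVec_mul, Matrix.vecMul_transpose]

/-- The standard basis vectors of `ℂ⁴`, numbered from `0`. -/
def e (i : Fin 4) : Fin 4 → ℂ := Pi.single i 1

/-- `(x + y)/√2`. -/
def sPlus (x y : Mat4) : Mat4 := ((1 / Real.sqrt 2 : ℝ) : ℂ) • (x + y)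

/-- `i(x - y)/√2`. -/
def sMinus (x y : Mat4) : Mat4 := (Complex.I * ((1 / Real.sqrt 2 : ℝ) : ℂ)) • (x - y)

/-- The ordered orthonormal basis of `⋀² ℂ⁴` (indices of the `e i` are shifted down by one). -/
def wedgeBasis : Fin 6 → Mat4 :=
  ![sMinus (wedge (e 0) (e 1)) (wedge (e 2) (e 3)),
    sPlus (wedge (e 0) (e 1)) (wedge (e 2) (e 3)),
    sMinus (wedge (e 1) (e 2)) (wedge (e 0) (e 3)),
    sPlus (wedge (e 1) (e 3)) (wedge (e 2) (e 0)),
    sMinus (wedge (e 1) (e 3)) (wedge (e 2) (e 0)),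
    sPlus (wedge (e 1) (e 2)) (wedge (e 0) (e 3))]

/-- Rescaling of an operator by a fourth root of its inverse determinant, so that it gets
determinant one. Another choice of the root changes `so6` at most by a global sign, which affects
neither least denominator exponents nor patterns. -/
def toDetOne (U : Mat4) : Mat4 := (U.det ^ (-(1 / 4) : ℂ)) • U

/-- The representation of an operator in the ordered basis of `⋀² ℂ⁴`. For a unitary operator this
is a matrix in `SO(6)`, that is, its entries are real. -/
def so6 (U : Mat4) : Matrix (Fin 6) (Fin 6) ℂ :=
  Matrix.of fun j k => wedgeInner (wedgeBasis j) (wedgeAct (toDetOne U) (wedgeBasis k))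

/-- `ℓ` is a denominator exponent of `V` if `√2 ^ ℓ V` is an integer matrix. -/
def IsDenominatorExponent (V : Matrix (Fin 6) (Fin 6) ℂ) (ℓ : ℕ) : Prop :=
  ∃ M : Matrix (Fin 6) (Fin 6) ℤ, ((Real.sqrt 2 : ℝ) : ℂ) ^ ℓ • V = M.map (Int.cast : ℤ → ℂ)

/-- The least denominator exponent. -/
def lde (V : Matrix (Fin 6) (Fin 6) ℂ) : ℕ := sInf {ℓ | IsDenominatorExponent V ℓ}

/-- The `ℓ`-residue of `V`: the parities of the entries of `√2 ^ ℓ V` (which are integers when `ℓ`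
is a denominator exponent of `V`). -/
def residue (ℓ : ℕ) (V : Matrix (Fin 6) (Fin 6) ℂ) : Matrix (Fin 6) (Fin 6) (ZMod 2) :=
  Matrix.of fun i j => ((⌊(((Real.sqrt 2 : ℝ) : ℂ) ^ ℓ * V i j).re⌋ : ℤ) : ZMod 2)

/-- The row pattern of `V`: the partition of the set of row indices into the classes of equal rows
of the residue of `V` at its least denominator exponent. -/
def pattern (V : Matrix (Fin 6) (Fin 6) ℂ) : Set (Set (Fin 6)) :=
  (Setoid.ker fun i => (residue (lde V) V) i).classes

/-! ### The synthesis algorithm -/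

/-- The generator of index `j` lowers the least denominator exponent of `U` to `k`. -/
def Reduces (U : Mat4) (k : ℕ) (j : Fin 15) : Prop :=
  lde ((so6 (gen j))ᵀ * so6 U) = k

open Classical in
/-- The synthesis algorithm on an operator `U` of least denominator exponent `k`. At exponent `0`
it outputs `U` itself as the last letter. At exponent `k + 1` it outputs the generator `r` of
lowest index that lowers the exponent to `k`, and goes on with `r† U`. (If there were no such
generator, it would stop and output the whole remaining operator as one letter.) -/
def synthesize : ℕ → Mat4 → List Mat4
  | 0, U => [U]
  | k + 1, U =>
    if h : ∃ j, Reduces U k j then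
      gen (Fin.find (Reduces U k) h) :: synthesize k ((gen (Fin.find (Reduces U k) h))ᴴ * U)
    else [U]

/-- The word that the synthesis algorithm outputs on input `U`. -/
def normalForm (U : Mat4) : List Mat4 := synthesize (lde (so6 U)) U

/-- The set of all normal forms of Clifford+`CS` operators. -/
def normalForms : Set (List Mat4) := {w | ∃ U ∈ cliffordCS, normalForm U = w}

/-! ### The automata -/

/-- The concatenation of two automata: on the disjoint union of the states, with an additional
`ε`-transition from each final state of the first to each initial state of the second. -/
def concat {α σ τ : Type} (A : εNFA α σ) (B : εNFA α τ) : εNFA α (σ ⊕ τ) where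
  step
    | Sum.inl q, a =>
      Sum.inl '' A.step q a ∪ {t | a = none ∧ q ∈ A.accept ∧ t ∈ Sum.inr '' B.start}
    | Sum.inr q, a => Sum.inr '' B.step q a
  start := Sum.inl '' A.start
  accept := Sum.inr '' B.accept

/-- The automaton that reads a single Clifford operator. Its states are an initial state `none`
and, for each Clifford operator `C`, a final state `some C`. -/
def cliffordAutomaton : εNFA alphabet (Option clifford) where
  step
    | none, some a => {t | ∃ C : clifford, (a : Mat4) = C ∧ t = some C}
    | _, _ => ∅
  start := {none}
  accept := {t | t ≠ none}

/-- The automaton with states `1, …, m` (`s : Fin m` stands for the state `s + 1`), initial states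
`n, …, m` and all states final; from the state `s` it can only read the `s`-th generator, and can
then go to each state `t` such that the patterns of the `s`-th and `t`-th generators are
disjoint. -/
def genAutomaton (n m : ℕ) (hm : m ≤ 15) : εNFA alphabet (Fin m) where
  step
    | s, some a => {t | (a : Mat4) = gen (s.castLE hm) ∧
        pattern (so6 (gen (s.castLE hm))) ∩ pattern (so6 (gen (t.castLE hm))) = ∅}
    | _, none => ∅
  start := {s | n ≤ (s : ℕ) + 1}
  accept := Set.univ

/-- The automaton `𝔖₁,₃ ∘ 𝔖₄,₉ ∘ 𝔖₁₀,₁₅ ∘ ℭ`. -/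
def normalFormAutomaton :
    εNFA alphabet (((Fin 3 ⊕ Fin 9) ⊕ Fin 15) ⊕ Option clifford) :=
  concat
    (concat
      (concat (genAutomaton 1 3 (by norm_num)) (genAutomaton 4 9 (by norm_num)))
      (genAutomaton 10 15 (by norm_num)))
    cliffordAutomaton

end CliffordCS

end

noncomputable section

namespace CliffordCS

/-! ### The second exterior power -/

/-! The action on `⋀² ℂ⁴` turns the problem into arithmetic modulo 2. Scaled by a power of `√2`, and
up to sign, the image of a Clifford+`CS` operator is an integer matrix `M` with `M * Mᵀ = 2 ^ n`
(`Rep`), and the operators with `n = 0` are exactly the Clifford operators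
(`exists_rep_of_mem_clifford`, `Rep.mem_clifford`). The scaled image of a generator is the identity
plus a signed perfect matching of the six indices, so modulo 2 it adds to each row the row matched
with it (`res_genRep_mul`).

Consequently the row pattern of a product is determined by the generator and the previous row
pattern, as long as the matching does not refine that pattern. Only 31 patterns arise: six distinct
rows, a perfect matching, or a pair together with a quadruple. In a reduced word, where no letter
refines the pattern of what follows it, the residue never vanishes, so the least denominator
exponent is the number of letters (`Reduced.lde_so6`).

Conversely, removing a generator that does refine the pattern really shortens the word. This rests
on an exchange relation `r† s t = x D` with `D` Clifford, for matchings `r`, `s`, `t` with a common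
block (`exists_exchange`, `Reduced.isWord_conjTranspose_gen_mul`). Hence a generator lowers the
exponent if and only if its matching refines the row pattern (`Reduced.reduces_iff`), and the normal
forms are the words in which each letter is the lowest refining index, followed by a Clifford
operator (`mem_normalForms_iff`).

Whether a letter may be put in front of a normal word depends only on the pattern of that word, so
normality is tested by a finite-state process. Comparing it with the given automaton is a finite
check over letters, patterns and states (`accFrom_iff`, `isNormal_iff`). -/

/-- The matrix of `U ∧ U` in the basis `wedgeBasis`. -/
def wedgeRep (U : Mat4) : Matrix (Fin 6) (Fin 6) ℂ :=
  Matrix.of fun j k => wedgeInner (wedgeBasis j) (wedgeAct U (wedgeBasis k))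

theorem wedgeInner_add (x y z : Mat4) : wedgeInner x (y + z) = wedgeInner x y + wedgeInner x z := by
  simp only [wedgeInner, Matrix.add_apply, mul_add, Finset.sum_add_distrib]

theorem wedgeInner_smul (c : ℂ) (x y : Mat4) : wedgeInner x (c • y) = c * wedgeInner x y := by
  simp only [wedgeInner, Matrix.smul_apply, smul_eq_mul, Finset.mul_sum]
  refine Finset.sum_congr rfl fun a _ => Finset.sum_congr rfl fun b _ => by ring

theorem wedgeInner_sum {ι : Type*} (s : Finset ι) (x : Mat4) (f : ι → Mat4) :
    wedgeInner x (∑ k ∈ s, f k) = ∑ k ∈ s, wedgeInner x (f k) := by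
  classical
  induction s using Finset.induction_on with
  | empty => simp [wedgeInner]
  | insert a s ha ih => rw [Finset.sum_insert ha, Finset.sum_insert ha, wedgeInner_add, ih]

theorem add_wedgeInner (x y z : Mat4) : wedgeInner (x + y) z = wedgeInner x z + wedgeInner y z := by
  simp only [wedgeInner, Matrix.add_apply, star_add, add_mul, mul_add, Finset.sum_add_distrib]

theorem smul_wedgeInner (c : ℂ) (x y : Mat4) : wedgeInner (c • x) y = star c * wedgeInner x y := by
  simp only [wedgeInner, Matrix.smul_apply, smul_eq_mul, Finset.mul_sum, star_mul']
  refine Finset.sum_congr rfl fun a _ => Finset.sum_congr rfl fun b _ => by ring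

theorem inv_sqrt_two_sq : ((Real.sqrt 2 : ℝ) : ℂ)⁻¹ ^ 2 = 1 / 2 := by
  rw [inv_pow, ← Complex.ofReal_pow, Real.sq_sqrt (by norm_num)]
  norm_num

theorem sqrt_two_sq : ((Real.sqrt 2 : ℝ) : ℂ) ^ 2 = 2 := by
  rw [← Complex.ofReal_pow, Real.sq_sqrt (by norm_num)]
  norm_num

theorem sqrt_two_ne_zero : ((Real.sqrt 2 : ℝ) : ℂ) ≠ 0 := by
  simp

/-- The basis `wedgeBasis` spans the space of skew-symmetric matrices. -/
theorem sum_wedgeInner_smul (x : Mat4) (hx : xᵀ = -x) :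
    ∑ k, wedgeInner (wedgeBasis k) x • wedgeBasis k = x := by
  have h : ∀ a b, x b a = - x a b := fun a b => congrFun (congrFun hx a) b
  have hd : ∀ a, x a a = 0 := fun a => by
    have := h a a
    linear_combination (1 / 2 : ℂ) * this
  ext a b
  simp only [Fin.sum_univ_six, Matrix.add_apply, Matrix.smul_apply, smul_eq_mul, wedgeInner,
    Fin.sum_univ_four]
  fin_cases a <;> fin_cases b <;>
    simp [wedgeBasis, sPlus, sMinus, wedge, e, Matrix.vecMulVec_apply, hd, h 0 1, h 0 2, h 0 3,
      h 1 2, h 1 3, h 2 3]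
  all_goals
    ring_nf
    simp only [Complex.I_sq, inv_sqrt_two_sq]
    ring

theorem transpose_wedgeBasis (k : Fin 6) : (wedgeBasis k)ᵀ = -wedgeBasis k := by
  have hw : ∀ v w, (wedge v w)ᵀ = -wedge v w := fun v w => by
    simp [wedge, Matrix.transpose_sub, Matrix.transpose_vecMulVec]
  fin_cases k <;>
    simp [wedgeBasis, sPlus, sMinus, Matrix.transpose_smul, Matrix.transpose_add,
      Matrix.transpose_sub, hw] <;> module

theorem sum_wedgeRep_smul (U : Mat4) (k : Fin 6) :
    ∑ l, wedgeRep U l k • wedgeBasis l = U * wedgeBasis k * Uᵀ := by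
  refine sum_wedgeInner_smul (wedgeAct U (wedgeBasis k)) ?_
  simp only [wedgeAct, Matrix.transpose_mul, Matrix.transpose_transpose, transpose_wedgeBasis]
  simp [Matrix.mul_assoc]

theorem wedgeRep_mul (U V : Mat4) : wedgeRep (U * V) = wedgeRep U * wedgeRep V := by
  ext j k
  have : wedgeAct (U * V) (wedgeBasis k) =
      ∑ l, wedgeRep V l k • wedgeAct U (wedgeBasis l) := by
    have h := congrArg (fun x => U * x * Uᵀ) (sum_wedgeRep_smul V k)
    simp only [Matrix.mul_sum, Matrix.sum_mul, Matrix.mul_smul, Matrix.smul_mul,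
      Matrix.mul_assoc] at h
    simp only [wedgeAct, h, Matrix.transpose_mul, Matrix.mul_assoc]
  simp only [wedgeRep, Matrix.of_apply, Matrix.mul_apply, this, wedgeInner_sum, wedgeInner_smul]
  exact Finset.sum_congr rfl fun l _ => mul_comm _ _

theorem wedgeRep_smul (c : ℂ) (U : Mat4) : wedgeRep (c • U) = c ^ 2 • wedgeRep U := by
  ext j k
  simp only [wedgeRep, wedgeAct, Matrix.of_apply, Matrix.smul_apply, smul_eq_mul,
    Matrix.transpose_smul, Matrix.smul_mul, Matrix.mul_smul, wedgeInner_smul]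
  ring

/-- The action is quadratic in `U`, so only the square of the fourth root matters. It is a square
root of the inverse determinant, which leaves just a sign undetermined. -/
theorem so6_eq (U : Mat4) : so6 U = (U.det ^ (-(1 / 4) : ℂ)) ^ 2 • wedgeRep U := by
  rw [← wedgeRep_smul]
  rfl

/-! ### Minors -/

section Minors

variable {K : Type*} [CommRing K]

/-- The first pair of indices in each element of `wedgeBasis`. -/
def pairP : Fin 6 → Fin 4 × Fin 4 := ![(0, 1), (0, 1), (1, 2), (1, 3), (1, 3), (1, 2)]

/-- The second pair of indices in each element of `wedgeBasis`. -/
def pairQ : Fin 6 → Fin 4 × Fin 4 := ![(2, 3), (2, 3), (0, 3), (2, 0), (2, 0), (0, 3)]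

/-- The sign of the second pair of indices in each element of `wedgeBasis`. -/
def pairSign : Fin 6 → K := ![-1, 1, -1, 1, -1, 1]

/-- The phases of the elements of `wedgeBasis`. -/
def pairPhase (i : K) : Fin 6 → K := ![i, 1, i, 1, i, 1]

/-- The minor of `U` in two rows and two columns. -/
def minor (U : Matrix (Fin 4) (Fin 4) K) (p q : Fin 4 × Fin 4) : K :=
  U p.1 q.1 * U p.2 q.2 - U p.1 q.2 * U p.2 q.1

/-- Up to a factor `2`, the coefficient of `wedgeRep U`. -/
def minorSum (i : K) (U : Matrix (Fin 4) (Fin 4) K) (j k : Fin 6) : K :=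
  pairPhase (-i) j * pairPhase i k *
    (minor U (pairP j) (pairP k) + pairSign k * minor U (pairP j) (pairQ k) +
      pairSign j * (minor U (pairQ j) (pairP k) + pairSign k * minor U (pairQ j) (pairQ k)))

theorem map_pairSign {L : Type*} [CommRing L] (φ : K →+* L) (j : Fin 6) :
    φ (pairSign j) = pairSign j := by
  fin_cases j <;> simp [pairSign]

theorem map_pairPhase {L : Type*} [CommRing L] (φ : K →+* L) (i : K) (j : Fin 6) :
    φ (pairPhase i j) = pairPhase (φ i) j := by
  fin_cases j <;> simp [pairPhase]

theorem map_minor {L : Type*} [CommRing L] (φ : K →+* L) (U : Matrix (Fin 4) (Fin 4) K)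
    (p q : Fin 4 × Fin 4) : φ (minor U p q) = minor (U.map φ) p q := by
  simp [minor]

/-- Minors are stated over any commutative ring so that they can be evaluated by the kernel over the
Gaussian integers and then transported to `ℂ`. -/
theorem map_minorSum {L : Type*} [CommRing L] (φ : K →+* L) (i : K)
    (U : Matrix (Fin 4) (Fin 4) K) (j k : Fin 6) :
    φ (minorSum i U j k) = minorSum (φ i) (U.map φ) j k := by
  simp only [minorSum, map_mul, map_add, map_pairSign, map_pairPhase, map_minor, map_neg]

theorem minorSum_smul (c i : K) (U : Matrix (Fin 4) (Fin 4) K) (j k : Fin 6) :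
    minorSum i (c • U) j k = c ^ 2 * minorSum i U j k := by
  simp only [minorSum, minor, Matrix.smul_apply, smul_eq_mul]
  ring

/-- The expansion of a determinant of order four. -/
def detFour (U : Matrix (Fin 4) (Fin 4) K) : K :=
  minor U (0, 1) (0, 1) * minor U (2, 3) (2, 3) - minor U (0, 1) (0, 2) * minor U (2, 3) (1, 3) +
    minor U (0, 1) (0, 3) * minor U (2, 3) (1, 2) + minor U (0, 1) (1, 2) * minor U (2, 3) (0, 3) -
    minor U (0, 1) (1, 3) * minor U (2, 3) (0, 2) + minor U (0, 1) (2, 3) * minor U (2, 3) (0, 1)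

theorem det_eq_detFour (U : Matrix (Fin 4) (Fin 4) K) : U.det = detFour U := by
  simp [Matrix.det_succ_row_zero, Fin.sum_univ_succ, detFour, minor, Fin.succAbove]
  ring

end Minors

theorem wedgeBasis_eq (k : Fin 6) : wedgeBasis k =
    (((Real.sqrt 2 : ℝ) : ℂ)⁻¹ * pairPhase Complex.I k) •
      (wedge (e (pairP k).1) (e (pairP k).2) +
        (pairSign k : ℂ) • wedge (e (pairQ k).1) (e (pairQ k).2)) := by
  fin_cases k <;>
    simp [wedgeBasis, pairPhase, pairP, pairSign, pairQ, sPlus, sMinus, sub_eq_add_neg, mul_comm]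

theorem wedgeInner_wedge_e (U : Mat4) (p q : Fin 4 × Fin 4) :
    wedgeInner (wedge (e p.1) (e p.2)) (wedgeAct U (wedge (e q.1) (e q.2))) = minor U p q := by
  rw [wedgeAct_wedge, wedgeInner_wedge]
  have h : ∀ i j, star (e i) ⬝ᵥ U *ᵥ e j = U i j := fun i j => by
    simp [e]
  simp only [h, Matrix.det_fin_two_of, minor]

theorem two_mul_wedgeRep (U : Mat4) (j k : Fin 6) :
    2 * wedgeRep U j k = minorSum Complex.I U j k := by
  have h1 : ∀ x y : Mat4, wedgeAct U (x + y) = wedgeAct U x + wedgeAct U y := fun x y => by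
    simp only [wedgeAct, Matrix.mul_add, Matrix.add_mul]
  have h2 : ∀ (c : ℂ) (x : Mat4), wedgeAct U (c • x) = c • wedgeAct U x := fun c x => by
    simp only [wedgeAct, Matrix.mul_smul, Matrix.smul_mul]
  have h3 : star (pairPhase Complex.I j) = pairPhase (-Complex.I) j := by
    fin_cases j <;> simp [pairPhase]
  have h4 : star (pairSign j : ℂ) = pairSign j := by
    fin_cases j <;> simp [pairSign]
  have h5 : star (((Real.sqrt 2 : ℝ) : ℂ)⁻¹) = ((Real.sqrt 2 : ℝ) : ℂ)⁻¹ := by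
    simp
  simp only [wedgeRep, Matrix.of_apply, wedgeBasis_eq j, wedgeBasis_eq k, h1, h2, wedgeInner_add,
    wedgeInner_smul, add_wedgeInner, smul_wedgeInner, wedgeInner_wedge_e, star_mul', h3, h4, h5,
    minorSum]
  linear_combination (2 * pairPhase (-Complex.I) j * pairPhase Complex.I k *
    (minor U (pairP j) (pairP k) + pairSign k * minor U (pairP j) (pairQ k) +
      pairSign j * (minor U (pairQ j) (pairP k) + pairSign k * minor U (pairQ j) (pairQ k)))) *
    inv_sqrt_two_sq

/-! ### Operators represented by scaled integer matrices -/

/-- The matrix `M / √2 ^ n` represents `U` up to a global sign. -/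
structure Rep (U : Mat4) (n : ℕ) (M : Matrix (Fin 6) (Fin 6) ℤ) : Prop where
  det_sq : U.det ^ 2 = (-1) ^ n
  mul_transpose : M * Mᵀ = (2 ^ n : ℤ) • (1 : Matrix (Fin 6) (Fin 6) ℤ)
  exists_phase : ∃ ε : ℂ, ε ^ 2 * U.det = 1 ∧
    (((Real.sqrt 2 : ℝ) : ℂ) ^ n * ε) • wedgeRep U = M.map (Int.cast : ℤ → ℂ)

theorem map_intCast_mul (M N : Matrix (Fin 6) (Fin 6) ℤ) :
    (M * N).map (Int.cast : ℤ → ℂ) = M.map Int.cast * N.map Int.cast :=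
  Matrix.map_mul (f := Int.castRingHom ℂ)

theorem Rep.mul {U V : Mat4} {m n : ℕ} {M N : Matrix (Fin 6) (Fin 6) ℤ} (hU : Rep U m M)
    (hV : Rep V n N) : Rep (U * V) (m + n) (M * N) := by
  obtain ⟨ε, hε, hM⟩ := hU.exists_phase
  obtain ⟨δ, hδ, hN⟩ := hV.exists_phase
  refine ⟨?_, ?_, ε * δ, ?_, ?_⟩
  · rw [Matrix.det_mul, mul_pow, hU.det_sq, hV.det_sq, pow_add]
  · rw [Matrix.transpose_mul, Matrix.mul_assoc, ← Matrix.mul_assoc N, hV.mul_transpose,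
      Matrix.smul_mul, Matrix.one_mul, Matrix.mul_smul, hU.mul_transpose, smul_smul, pow_add,
      mul_comm]
  · rw [Matrix.det_mul]
    linear_combination δ ^ 2 * V.det * hε + hδ
  · rw [map_intCast_mul, ← hM, ← hN, wedgeRep_mul, Matrix.smul_mul, Matrix.mul_smul, smul_smul]
    congr 1
    ring

/-- An even matrix absorbs two factors `√2`. This is how exponents are brought down to `0`, where
Clifford operators are recognised. -/
theorem Rep.half {U : Mat4} {n : ℕ} {M : Matrix (Fin 6) (Fin 6) ℤ}
    (hU : Rep U (n + 2) ((2 : ℤ) • M)) : Rep U n M := by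
  obtain ⟨ε, hε, hM⟩ := hU.exists_phase
  refine ⟨by simpa [pow_add] using hU.det_sq, ?_, ε, hε, ?_⟩
  · have h := hU.mul_transpose
    rw [Matrix.transpose_smul, Matrix.smul_mul, Matrix.mul_smul, smul_smul, pow_add, mul_comm,
      mul_smul] at h
    ext i j
    have hij := congrFun (congrFun h i) j
    simp only [Matrix.smul_apply, smul_eq_mul] at hij ⊢
    linarith
  · ext i j
    have hij := congrFun (congrFun hM i) j
    simp only [Matrix.smul_apply, smul_eq_mul, Matrix.map_apply, Int.cast_mul, pow_add,
      sqrt_two_sq, Int.cast_ofNat] at hij ⊢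
    linear_combination hij / 2

theorem Rep.one : Rep 1 0 1 := by
  refine ⟨by simp, by simp, 1, by simp, ?_⟩
  ext j k
  have h := two_mul_wedgeRep 1 j k
  have h2 : minorSum Complex.I (1 : Mat4) j k = 2 * (1 : Matrix (Fin 6) (Fin 6) ℂ) j k := by
    fin_cases j <;> fin_cases k <;>
      simp [minorSum, pairPhase, minor, pairP, pairQ, pairSign, Matrix.one_apply] <;> norm_num
  rw [h2] at h
  have h3 : wedgeRep 1 j k = (1 : Matrix (Fin 6) (Fin 6) ℂ) j k := by linear_combination h / 2
  simp [h3, Matrix.one_apply]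

theorem Rep.inv {U V : Mat4} {n : ℕ} {M : Matrix (Fin 6) (Fin 6) ℤ} (hU : Rep U n M)
    (h : U * V = 1) : Rep V n Mᵀ := by
  obtain ⟨ε, hε, hM⟩ := hU.exists_phase
  have hdet : U.det * V.det = 1 := by rw [← Matrix.det_mul, h, Matrix.det_one]
  have hε0 : ε ≠ 0 := by
    rintro rfl
    simp at hε
  have hs := sqrt_two_ne_zero
  have hone : wedgeRep 1 = 1 := by
    obtain ⟨δ, hδ, h1⟩ := Rep.one.exists_phase
    have h2 : δ ^ 2 = 1 := by simpa using hδ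
    -- `Rep.one` gives the identity only up to a sign `δ`; since `wedgeRep 1` is idempotent and
    -- invertible, it is the identity itself.
    have h3 : wedgeRep 1 * wedgeRep 1 = wedgeRep 1 := by rw [← wedgeRep_mul, Matrix.one_mul]
    have h4 : δ • wedgeRep 1 = 1 := by
      rw [pow_zero, one_mul] at h1
      rw [h1]
      ext i j
      simp [Matrix.one_apply]
    have h5 : wedgeRep 1 * (δ • wedgeRep 1) = δ • wedgeRep 1 := by rw [Matrix.mul_smul, h3]
    rw [h4, Matrix.mul_one] at h5
    exact h5
  have hMV : M.map (Int.cast : ℤ → ℂ) * (((Real.sqrt 2 : ℝ) : ℂ) ^ n * ε⁻¹) • wedgeRep V =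
      (2 ^ n : ℂ) • (1 : Matrix (Fin 6) (Fin 6) ℂ) := by
    rw [← hM, Matrix.smul_mul, Matrix.mul_smul, ← wedgeRep_mul, h, hone, smul_smul]
    congr 1
    rw [← sqrt_two_sq, ← pow_mul]
    field_simp
    ring
  have hMM : M.map (Int.cast : ℤ → ℂ) * Mᵀ.map Int.cast =
      (2 ^ n : ℂ) • (1 : Matrix (Fin 6) (Fin 6) ℂ) := by
    rw [← map_intCast_mul, hU.mul_transpose]
    ext i j
    simp only [Matrix.map_apply, Matrix.smul_apply, smul_eq_mul, Matrix.one_apply]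
    split_ifs <;> simp
  have h2n : (2 ^ n : ℂ) ≠ 0 := pow_ne_zero _ two_ne_zero
  -- A one-sided inverse of a square matrix is two-sided. This gives `Mᵀ * M = 2 ^ n`, and it
  -- identifies the scaled image of `V` with `Mᵀ`.
  have hcancel : ((2 ^ n : ℂ)⁻¹ • Mᵀ.map (Int.cast : ℤ → ℂ)) * M.map Int.cast = 1 := by
    rw [mul_eq_one_comm, Matrix.mul_smul, hMM, smul_smul, inv_mul_cancel₀ h2n, one_smul]
  refine ⟨?_, ?_, ε⁻¹, ?_, ?_⟩
  · have h1 := hU.det_sq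
    have h2 : ((-1 : ℂ) ^ n) * (-1) ^ n = 1 := by rw [← mul_pow]; simp
    have h3 : (U.det * V.det) ^ 2 = 1 := by rw [hdet, one_pow]
    rw [mul_pow, h1] at h3
    linear_combination (-1) ^ n * h3 - V.det ^ 2 * h2
  · rw [Matrix.transpose_transpose]
    have h1 : Mᵀ.map (Int.cast : ℤ → ℂ) * M.map Int.cast =
        (2 ^ n : ℂ) • (1 : Matrix (Fin 6) (Fin 6) ℂ) := by
      rw [Matrix.smul_mul] at hcancel
      rw [← hcancel, smul_smul, mul_inv_cancel₀ h2n, one_smul]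
    rw [← map_intCast_mul] at h1
    ext i j
    have hij := congrFun (congrFun h1 i) j
    by_cases hd : i = j
    · simp [hd] at hij ⊢
      exact_mod_cast hij
    · simp [hd] at hij ⊢
      exact_mod_cast hij
  · field_simp
    linear_combination ε ^ 2 * hdet - V.det * hε
  · calc _ = ((2 ^ n : ℂ)⁻¹ • Mᵀ.map (Int.cast : ℤ → ℂ)) * M.map Int.cast *
          (((Real.sqrt 2 : ℝ) : ℂ) ^ n * ε⁻¹) • wedgeRep V := by
          rw [hcancel, Matrix.one_mul]
      _ = _ := by
          rw [Matrix.mul_assoc, hMV, Matrix.smul_mul, Matrix.mul_smul, smul_smul,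
            inv_mul_cancel₀ h2n, one_smul, Matrix.mul_one]

/-- The matrix `so6 U` is one of the two scaled integer matrices that represent `U`. -/
theorem Rep.exists_so6 {U : Mat4} {n : ℕ} {M : Matrix (Fin 6) (Fin 6) ℤ} (hU : Rep U n M) :
    ∃ N, (N = M ∨ N = -M) ∧
      ((Real.sqrt 2 : ℝ) : ℂ) ^ n • so6 U = N.map (Int.cast : ℤ → ℂ) := by
  obtain ⟨ε, hε, hM⟩ := hU.exists_phase
  have hdet : U.det ≠ 0 := by
    intro h
    simp [h] at hε
  have h1 : ((U.det ^ (-(1 / 4) : ℂ)) ^ 2) ^ 2 * U.det = 1 := by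
    rw [← pow_mul, ← Complex.cpow_nat_mul]
    norm_num
    rw [Complex.cpow_neg_one, inv_mul_cancel₀ hdet]
  have h2 : (U.det ^ (-(1 / 4) : ℂ)) ^ 2 = ε ∨ (U.det ^ (-(1 / 4) : ℂ)) ^ 2 = -ε := by
    rw [← sq_eq_sq_iff_eq_or_eq_neg]
    exact mul_right_cancel₀ hdet (h1.trans hε.symm)
  rcases h2 with h2 | h2
  · exact ⟨M, Or.inl rfl, by rw [so6_eq, h2, smul_smul, hM]⟩
  · refine ⟨-M, Or.inr rfl, ?_⟩
    rw [so6_eq, h2, smul_smul, mul_neg, neg_smul, hM]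
    ext i j
    simp

/-! ### Operators with Gaussian integer entries -/

/-- A matrix `A = c U` over the Gaussian integers, with `c ^ 2 = N`, reduces every condition of
`Rep` to decidable identities. Here `d` is the determinant of `U`, and the phase of `U` is `κ / √2 ^
n`, so that `κ ^ 2 * d = 2 ^ n` expresses its normalisation. -/
theorem Rep.of_gaussianInt (A : Matrix (Fin 4) (Fin 4) GaussianInt) (N : ℕ) (d κ : GaussianInt)
    {U : Mat4} {n : ℕ} {M : Matrix (Fin 6) (Fin 6) ℤ} (c : ℂ) (hc : c ^ 2 = N) (hN : N ≠ 0)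
    (hA : c • U = A.map GaussianInt.toComplex) (hd : detFour A = (N : GaussianInt) ^ 2 * d)
    (hd2 : d ^ 2 = (-1) ^ n) (hκ : κ ^ 2 * d = 2 ^ n)
    (hM : M * Mᵀ = (2 ^ n : ℤ) • (1 : Matrix (Fin 6) (Fin 6) ℤ))
    (h : ∀ j k, κ * minorSum ⟨0, 1⟩ A j k = 2 * N * (M j k : GaussianInt)) : Rep U n M := by
  have hN' : (N : ℂ) ≠ 0 := by exact_mod_cast hN
  have hs := sqrt_two_ne_zero
  have hdet : U.det = GaussianInt.toComplex d := by
    have h1 : (A.map GaussianInt.toComplex).det = (N : ℂ) ^ 2 * GaussianInt.toComplex d := by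
      have := congrArg GaussianInt.toComplex (det_eq_detFour A)
      rw [RingHom.map_det, hd, map_mul, map_pow, map_natCast] at this
      exact this
    rw [← hA, Matrix.det_smul, Fintype.card_fin, ← hc] at h1
    have h2 : c ≠ 0 := by
      rintro rfl
      exact hN' (by simpa using hc.symm)
    have h3 : c ^ 4 ≠ 0 := pow_ne_zero _ h2
    exact mul_left_cancel₀ h3 (by rw [h1]; ring)
  have hsn : (((Real.sqrt 2 : ℝ) : ℂ) ^ n) ^ 2 = 2 ^ n := by
    rw [← pow_mul, mul_comm, pow_mul, sqrt_two_sq]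
  have h2n : (2 : ℂ) ^ n ≠ 0 := pow_ne_zero _ two_ne_zero
  refine ⟨?_, hM, GaussianInt.toComplex κ / ((Real.sqrt 2 : ℝ) : ℂ) ^ n, ?_, ?_⟩
  · rw [hdet, ← map_pow, hd2]
    simp
  · have h1 := congrArg GaussianInt.toComplex hκ
    simp only [map_mul, map_pow, map_ofNat] at h1
    rw [hdet, div_pow, hsn, div_mul_eq_mul_div, h1, div_self h2n]
  · rw [mul_div_cancel₀ _ (pow_ne_zero _ hs)]
    ext j k
    have h1 := congrArg GaussianInt.toComplex (h j k)
    have hI : GaussianInt.toComplex ⟨0, 1⟩ = Complex.I := by simp [GaussianInt.toComplex_def]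
    rw [map_mul, map_minorSum, hI] at h1
    have h2 : A.map (GaussianInt.toComplex) = c • U := hA.symm
    rw [h2, minorSum_smul, ← two_mul_wedgeRep, hc] at h1
    simp only [map_mul, map_natCast, map_intCast, map_ofNat] at h1
    simp only [Matrix.smul_apply, smul_eq_mul, Matrix.map_apply]
    refine mul_left_cancel₀ (mul_ne_zero two_ne_zero hN') ?_
    linear_combination h1

/-! ### The gates -/

/-- The matrix with entry `s i` at the position `(i, f i)` and zeros elsewhere. -/
def signedPerm (f : Equiv.Perm (Fin 6)) (s : Fin 6 → ℤ) : Matrix (Fin 6) (Fin 6) ℤ :=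
  Matrix.of fun i k => if k = f i then s i else 0

/-- The Kronecker product of two matrices of order two over a ring. -/
def kron {K : Type*} [Mul K] (A B : Matrix (Fin 2) (Fin 2) K) : Matrix (Fin 4) (Fin 4) K :=
  !![A 0 0 * B 0 0, A 0 0 * B 0 1, A 0 1 * B 0 0, A 0 1 * B 0 1;
    A 0 0 * B 1 0, A 0 0 * B 1 1, A 0 1 * B 1 0, A 0 1 * B 1 1;
    A 1 0 * B 0 0, A 1 0 * B 0 1, A 1 1 * B 0 0, A 1 1 * B 0 1;
    A 1 0 * B 1 0, A 1 0 * B 1 1, A 1 1 * B 1 0, A 1 1 * B 1 1]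

theorem tensor_eq_kron (A B : Mat2) : tensor A B = kron A B := by
  ext i j
  fin_cases i <;> fin_cases j <;> rfl

theorem tensor_mul_tensor (A B C D : Mat2) :
    tensor A B * tensor C D = tensor (A * C) (B * D) := by
  simp only [tensor, Matrix.reindex_apply, Matrix.submatrix_mul_equiv, Matrix.mul_kronecker_mul]

theorem tensor_one_one : tensor 1 1 = 1 := by
  simp [tensor]

theorem smul_tensor (c : ℂ) (A B : Mat2) : tensor (c • A) B = c • tensor A B := by
  simp only [tensor, Matrix.smul_kronecker]
  rfl

theorem tensor_smul (c : ℂ) (A B : Mat2) : tensor A (c • B) = c • tensor A B := by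
  simp only [tensor, Matrix.kronecker_smul]
  rfl

theorem sqrt_two_mul_inv : ((Real.sqrt 2 : ℝ) : ℂ) * ((1 / Real.sqrt 2 : ℝ) : ℂ) = 1 := by
  push_cast
  field_simp

theorem rep_H_one : Rep (tensor H 1) 0
    (signedPerm (Equiv.swap 0 2) ![-1, 1, -1, -1, -1, -1]) := by
  refine Rep.of_gaussianInt !![1, 0, 1, 0; 0, 1, 0, 1; 1, 0, -1, 0; 0, 1, 0, -1] 2 1 1
    ((Real.sqrt 2 : ℝ) : ℂ) (by exact_mod_cast sqrt_two_sq) (by norm_num) ?_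
    (by decide +kernel) (by decide +kernel) (by decide +kernel) (by decide +kernel)
    (by decide +kernel)
  rw [H, smul_tensor, smul_smul, sqrt_two_mul_inv, one_smul, tensor_eq_kron]
  ext i j
  fin_cases i <;> fin_cases j <;> simp [kron]

theorem rep_one_H : Rep (tensor 1 H) 0
    (signedPerm (Equiv.swap 3 5) ![-1, -1, -1, -1, 1, -1]) := by
  refine Rep.of_gaussianInt !![1, 1, 0, 0; 1, -1, 0, 0; 0, 0, 1, 1; 0, 0, 1, -1] 2 1 1
    ((Real.sqrt 2 : ℝ) : ℂ) (by exact_mod_cast sqrt_two_sq) (by norm_num) ?_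
    (by decide +kernel) (by decide +kernel) (by decide +kernel) (by decide +kernel)
    (by decide +kernel)
  rw [H, tensor_smul, smul_smul, sqrt_two_mul_inv, one_smul, tensor_eq_kron]
  ext i j
  fin_cases i <;> fin_cases j <;> simp [kron]

theorem toComplex_I : GaussianInt.toComplex ⟨0, 1⟩ = Complex.I := by
  simp [GaussianInt.toComplex_def]

theorem rep_S_one : Rep (tensor S 1) 0
    (signedPerm (Equiv.swap 0 1) ![-1, 1, 1, 1, 1, 1]) := by
  refine Rep.of_gaussianInt (Matrix.diagonal ![1, 1, ⟨0, 1⟩, ⟨0, 1⟩]) 1 (-1) ⟨0, -1⟩ 1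
    (by norm_num) (by norm_num) ?_
    (by decide +kernel) (by decide +kernel) (by decide +kernel) (by decide +kernel)
    (by decide +kernel)
  rw [one_smul, tensor_eq_kron]
  ext i j
  fin_cases i <;> fin_cases j <;> simp [kron, S, toComplex_I]

theorem rep_one_S : Rep (tensor 1 S) 0
    (signedPerm (Equiv.swap 3 4) ![1, 1, 1, -1, 1, 1]) := by
  refine Rep.of_gaussianInt (Matrix.diagonal ![1, ⟨0, 1⟩, 1, ⟨0, 1⟩]) 1 (-1) ⟨0, -1⟩ 1
    (by norm_num) (by norm_num) ?_
    (by decide +kernel) (by decide +kernel) (by decide +kernel) (by decide +kernel)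
    (by decide +kernel)
  rw [one_smul, tensor_eq_kron]
  ext i j
  fin_cases i <;> fin_cases j <;> simp [kron, S, toComplex_I]

theorem rep_CZ : Rep CZ 0
    (signedPerm (Equiv.swap 0 1 * Equiv.swap 2 5 * Equiv.swap 3 4) ![-1, 1, -1, -1, 1, 1]) := by
  refine Rep.of_gaussianInt (Matrix.diagonal ![1, 1, 1, -1]) 1 (-1) ⟨0, -1⟩ 1
    (by norm_num) (by norm_num) ?_
    (by decide +kernel) (by decide +kernel) (by decide +kernel) (by decide +kernel)
    (by decide +kernel)
  rw [one_smul, CZ]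
  ext i j
  fin_cases i <;> fin_cases j <;> simp

/-! ### The generators -/

/-- The fixed-point-free involution whose orbits are the blocks of the pattern of a generator. -/
def partner : Fin 15 → Fin 6 → Fin 6 :=
  ![![3, 2, 1, 0, 5, 4], ![2, 4, 0, 5, 1, 3], ![1, 0, 5, 4, 3, 2], ![2, 5, 0, 4, 3, 1],
    ![1, 0, 4, 5, 2, 3], ![1, 0, 3, 2, 5, 4], ![5, 2, 1, 4, 3, 0], ![4, 2, 1, 5, 0, 3],
    ![2, 3, 0, 1, 5, 4], ![3, 4, 5, 0, 1, 2], ![3, 5, 4, 0, 2, 1], ![5, 4, 3, 2, 1, 0],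
    ![4, 3, 5, 1, 0, 2], ![4, 5, 3, 2, 0, 1], ![5, 3, 4, 1, 2, 0]]

/-- The signs of the off-diagonal entries of a generator. -/
def partnerSign : Fin 15 → Fin 6 → ℤ :=
  ![![-1, -1, 1, 1, -1, 1], ![1, -1, -1, 1, 1, -1], ![-1, 1, -1, -1, 1, 1],
    ![1, -1, -1, -1, 1, 1], ![-1, 1, -1, 1, 1, -1], ![-1, 1, -1, 1, -1, 1],
    ![-1, -1, 1, -1, 1, 1], ![-1, -1, 1, 1, 1, -1], ![1, -1, -1, 1, -1, 1],
    ![1, 1, 1, -1, -1, -1], ![1, -1, 1, -1, -1, 1], ![-1, 1, 1, -1, -1, 1],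
    ![1, 1, -1, -1, -1, 1], ![1, 1, 1, -1, -1, -1], ![1, 1, 1, -1, -1, -1]]

/-- The scaled matrix of a generator. -/
def genRep (j : Fin 15) : Matrix (Fin 6) (Fin 6) ℤ :=
  Matrix.of fun i k => if k = i then 1 else if k = partner j i then partnerSign j i else 0

/-- The Pauli matrices `X`, `Y`, `Z` over the Gaussian integers. -/
def gaussPauli : Fin 3 → Matrix (Fin 2) (Fin 2) GaussianInt :=
  ![!![0, 1; 1, 0], !![0, ⟨0, -1⟩; ⟨0, 1⟩, 0], !![1, 0; 0, -1]]

/-- The two Pauli operators that define a generator. -/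
def genPauli : Fin 15 → Matrix (Fin 4) (Fin 4) GaussianInt × Matrix (Fin 4) (Fin 4) GaussianInt :=
  let p := gaussPauli
  ![(kron (p 0) 1, kron 1 (p 0)), (kron (p 1) 1, kron 1 (p 1)), (kron (p 2) 1, kron 1 (p 2)),
    (kron (p 1) 1, kron 1 (p 2)), (kron (p 2) 1, kron 1 (p 1)), (kron (p 2) 1, kron 1 (p 0)),
    (kron (p 0) 1, kron 1 (p 2)), (kron (p 0) 1, kron 1 (p 1)), (kron (p 1) 1, kron 1 (p 0)),
    (kron (p 0) (p 0), kron (p 1) (p 1)), (kron (p 0) (p 0), kron (p 2) (p 1)),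
    (kron (p 2) (p 0), kron (p 1) (p 1)), (kron (p 1) (p 0), kron (p 0) (p 1)),
    (kron (p 2) (p 0), kron (p 0) (p 1)), (kron (p 1) (p 0), kron (p 2) (p 1))]

/-- Four times a generator, as a matrix over the Gaussian integers. -/
def gaussGen (j : Fin 15) : Matrix (Fin 4) (Fin 4) GaussianInt :=
  4 + (⟨-1, 1⟩ : GaussianInt) • ((1 - (genPauli j).1) * (1 - (genPauli j).2))

open NormedSpace in
/-- The exponential of a multiple of an idempotent. -/
theorem exp_smul_of_isIdempotentElem {n : Type*} [Fintype n] [DecidableEq n]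
    (c : ℂ) (E : Matrix n n ℂ) (hE : IsIdempotentElem E) :
    exp (c • E) = 1 + (Complex.exp c - 1) • E := by
  let _ : NormedRing (Matrix n n ℂ) := Matrix.linftyOpNormedRing
  let _ : NormedAlgebra ℂ (Matrix n n ℂ) := Matrix.linftyOpNormedAlgebra
  have h1 := NormedSpace.exp_series_hasSum_exp' (𝕂 := ℂ) (c • E)
  have h2 : HasSum (fun k : ℕ => ((Nat.factorial k : ℂ)⁻¹ * c ^ k)) (Complex.exp c) := by
    rw [Complex.exp_eq_exp_ℂ]
    exact NormedSpace.exp_series_hasSum_exp' (𝕂 := ℂ) c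
  have h3 : HasSum (fun k : ℕ => ((Nat.factorial k : ℂ)⁻¹ * c ^ k) • E) (Complex.exp c • E) :=
    h2.smul_const E
  have h4 : HasSum (fun k : ℕ => if k = 0 then 1 - E else 0) (1 - E) := hasSum_ite_eq 0 (1 - E)
  have h5 := h3.add h4
  have h6 : (fun k : ℕ => ((Nat.factorial k : ℂ)⁻¹ * c ^ k) • E + if k = 0 then 1 - E else 0) =
      fun k : ℕ => (Nat.factorial k : ℂ)⁻¹ • (c • E) ^ k := by
    ext1 k
    rcases k with _ | k
    · simp
    · rw [smul_pow, hE.pow_succ_eq k, smul_smul]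
      simp
  have h7 : Complex.exp c • E + (1 - E) = 1 + (Complex.exp c - 1) • E := by
    rw [sub_smul, one_smul]
    abel
  rw [h6, h7] at h5
  exact h1.unique h5

/-- The two factors `(1 - P) / 2` and `(1 - Q) / 2` are commuting idempotents, so their product is
idempotent and the exponential series collapses, with `exp (iπ/2) = i`. -/
theorem R_eq (P Q : Mat4) (hP : P * P = 1) (hQ : Q * Q = 1) (hPQ : P * Q = Q * P) :
    (4 : ℂ) • R P Q = 4 + (Complex.I - 1) • ((1 - P) * (1 - Q)) := by
  have hP' : ((1 : Mat4) - P) * (1 - P) = (2 : ℂ) • (1 - P) := by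
    rw [mul_sub, mul_one, sub_mul, one_mul, hP, two_smul]
    abel
  have hQ' : ((1 : Mat4) - Q) * (1 - Q) = (2 : ℂ) • (1 - Q) := by
    rw [mul_sub, mul_one, sub_mul, one_mul, hQ, two_smul]
    abel
  have hc : Commute ((1 : Mat4) - P) (1 - Q) :=
    ((Commute.one_left _).sub_left ((Commute.one_right P).sub_right hPQ))
  have hE : IsIdempotentElem (((1 / 2 : ℂ) • ((1 : Mat4) - P)) * ((1 / 2 : ℂ) • (1 - Q))) := by
    rw [smul_mul_smul_comm, IsIdempotentElem, smul_mul_smul_comm, Matrix.mul_assoc,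
      ← Matrix.mul_assoc (1 - Q), ← hc.eq, Matrix.mul_assoc (1 - P) (1 - Q), hQ',
      ← Matrix.mul_assoc, hP', smul_mul_smul_comm, smul_smul]
    norm_num
  rw [R, exp_smul_of_isIdempotentElem _ _ hE,
    show Complex.I * Real.pi / 2 = Real.pi / 2 * Complex.I by ring, Complex.exp_pi_div_two_mul_I,
    smul_mul_smul_comm, smul_smul, smul_add, smul_smul]
  congr 1
  · ext i j
    fin_cases i <;> fin_cases j <;> simp [Matrix.ofNat_apply]
  · congr 1
    ring

theorem map_kron (A B : Matrix (Fin 2) (Fin 2) GaussianInt) :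
    (kron A B).map GaussianInt.toComplex =
      tensor (A.map GaussianInt.toComplex) (B.map GaussianInt.toComplex) := by
  rw [tensor_eq_kron]
  ext i j
  fin_cases i <;> fin_cases j <;> simp [kron]

theorem map_gaussPauli : (gaussPauli 0).map GaussianInt.toComplex = X ∧
    (gaussPauli 1).map GaussianInt.toComplex = Y ∧
    (gaussPauli 2).map GaussianInt.toComplex = Z := by
  refine ⟨?_, ?_, ?_⟩ <;> ext i j <;> fin_cases i <;> fin_cases j <;>
    simp [gaussPauli, X, Y, Z, GaussianInt.toComplex_def]

theorem gen_eq_R (j : Fin 15) : gen j = R ((genPauli j).1.map GaussianInt.toComplex)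
    ((genPauli j).2.map GaussianInt.toComplex) := by
  have h1 : (1 : Matrix (Fin 2) (Fin 2) GaussianInt).map GaussianInt.toComplex = 1 :=
    Matrix.map_one _ (map_zero _) (map_one _)
  obtain ⟨hX, hY, hZ⟩ := map_gaussPauli
  fin_cases j <;> simp only [genPauli, gen, map_kron, h1, hX, hY, hZ, Fin.zero_eta, Fin.mk_one,
    Fin.reduceFinMk, Matrix.cons_val]

theorem four_smul_gen (j : Fin 15) :
    (4 : ℂ) • gen j = (gaussGen j).map GaussianInt.toComplex := by
  have hP : ∀ j, (genPauli j).1 * (genPauli j).1 = 1 := by decide +kernel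
  have hQ : ∀ j, (genPauli j).2 * (genPauli j).2 = 1 := by decide +kernel
  have hPQ : ∀ j, (genPauli j).1 * (genPauli j).2 = (genPauli j).2 * (genPauli j).1 := by
    decide +kernel
  let φ := GaussianInt.toComplex.mapMatrix (m := Fin 4)
  rw [gen_eq_R]
  change _ • R (φ (genPauli j).1) (φ (genPauli j).2) = φ (gaussGen j)
  have h2 : ∀ (c : GaussianInt) (A : Matrix (Fin 4) (Fin 4) GaussianInt),
      φ (c • A) = GaussianInt.toComplex c • φ A := fun c A => by
    ext a b
    simp [φ]
  rw [R_eq, gaussGen, map_add, h2, map_mul, map_sub, map_sub, map_one, map_ofNat]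
  · congr 2
    simp [GaussianInt.toComplex_def]
    ring
  · rw [← map_mul, hP, map_one]
  · rw [← map_mul, hQ, map_one]
  · rw [← map_mul, hPQ, map_mul]

theorem rep_gen (j : Fin 15) : Rep (gen j) 1 (genRep j) := by
  -- The scale is `4`, with square `16`. Each generator has determinant `i`, and `κ = 1 - i` is
  -- chosen since `(1 - i) ^ 2 * i = 2`.
  refine Rep.of_gaussianInt (gaussGen j) 16 ⟨0, 1⟩ ⟨1, -1⟩ 4 (by norm_num) (by norm_num)
    (four_smul_gen j) ?_ (by decide +kernel) (by decide +kernel) ?_ ?_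
  · revert j
    decide +kernel
  · revert j
    decide +kernel
  · revert j
    decide +kernel

theorem conjTranspose_gen_mul_gen (j : Fin 15) : (gen j)ᴴ * gen j = 1 := by
  have h : ∀ j, ((gaussGen j).map star)ᵀ * gaussGen j = 16 := by decide +kernel
  let φ := GaussianInt.toComplex.mapMatrix (m := Fin 4)
  have h1 : ((4 : ℂ) • gen j)ᴴ = φ ((gaussGen j).map star)ᵀ := by
    rw [four_smul_gen]
    ext a b
    simp [φ, GaussianInt.toComplex_star]
  have h2 : ((4 : ℂ) • gen j)ᴴ * ((4 : ℂ) • gen j) = 16 := by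
    rw [h1, four_smul_gen]
    change φ _ * φ _ = _
    rw [← map_mul, h, map_ofNat]
  rw [Matrix.conjTranspose_smul, Matrix.smul_mul, Matrix.mul_smul, smul_smul] at h2
  ext a b
  have h3 := congrFun (congrFun h2 a) b
  simp only [Matrix.smul_apply, smul_eq_mul] at h3
  have h4 : (16 : Mat4) a b = 16 * (1 : Mat4) a b := by
    fin_cases a <;> fin_cases b <;> simp [Matrix.ofNat_apply]
  rw [h4] at h3
  norm_num at h3
  exact h3

/-! ### Inverses and scalars in the Clifford group -/

theorem H_mul_H : H * H = 1 := by
  have h : ((1 / Real.sqrt 2 : ℝ) : ℂ) * ((1 / Real.sqrt 2 : ℝ) : ℂ) = 1 / 2 := by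
    rw [← inv_sqrt_two_sq]
    push_cast
    ring
  rw [H, smul_mul_smul_comm, h]
  ext i j
  fin_cases i <;> fin_cases j <;> simp <;> norm_num

theorem S_pow_four : S * (S * S * S) = 1 := by
  ext i j
  fin_cases i <;> fin_cases j <;> simp [S, Matrix.mul_apply, Fin.sum_univ_two]

theorem CZ_mul_CZ : CZ * CZ = 1 := by
  rw [CZ, Matrix.diagonal_mul_diagonal, ← Matrix.diagonal_one]
  congr 1
  ext i
  fin_cases i <;> simp

theorem mem_clifford_of_gate {g : Mat4} (h : g ∈ cliffordGates) : g ∈ clifford :=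
  Submonoid.subset_closure h

/-- Each gate has finite order, so its inverse is one of its powers and the monoid of circuits is a
group. -/
theorem exists_inv_mem_clifford {C : Mat4} (hC : C ∈ clifford) :
    ∃ D ∈ clifford, C * D = 1 ∧ D * C = 1 := by
  suffices h : ∃ D ∈ clifford, C * D = 1 by
    obtain ⟨D, hD, h⟩ := h
    exact ⟨D, hD, h, mul_eq_one_comm.mp h⟩
  induction hC using Submonoid.closure_induction with
  | mem g hg =>
    have hm := mem_clifford_of_gate hg
    rcases hg with rfl | rfl | rfl | rfl | rfl
    · exact ⟨_, hm, by rw [tensor_mul_tensor, H_mul_H, one_mul, tensor_one_one]⟩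
    · exact ⟨_, hm, by rw [tensor_mul_tensor, H_mul_H, one_mul, tensor_one_one]⟩
    · refine ⟨tensor S 1 * tensor S 1 * tensor S 1, mul_mem (mul_mem hm hm) hm, ?_⟩
      simp only [tensor_mul_tensor, S_pow_four, one_mul, tensor_one_one]
    · refine ⟨tensor 1 S * tensor 1 S * tensor 1 S, mul_mem (mul_mem hm hm) hm, ?_⟩
      simp only [tensor_mul_tensor, S_pow_four, one_mul, tensor_one_one]
    · exact ⟨_, hm, CZ_mul_CZ⟩
  | one => exact ⟨1, one_mem _, one_mul 1⟩
  | mul x y _ _ hx hy =>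
    obtain ⟨a, ha, hxa⟩ := hx
    obtain ⟨b, hb, hyb⟩ := hy
    exact ⟨b * a, mul_mem hb ha, by rw [mul_assoc, ← mul_assoc y, hyb, one_mul, hxa]⟩

theorem exists_rep_of_mem_clifford {C : Mat4} (hC : C ∈ clifford) : ∃ M, Rep C 0 M := by
  induction hC using Submonoid.closure_induction with
  | mem g hg =>
    rcases hg with rfl | rfl | rfl | rfl | rfl
    exacts [⟨_, rep_H_one⟩, ⟨_, rep_one_H⟩, ⟨_, rep_S_one⟩, ⟨_, rep_one_S⟩, ⟨_, rep_CZ⟩]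
  | one => exact ⟨_, Rep.one⟩
  | mul x y _ _ hx hy =>
    obtain ⟨M, hM⟩ := hx
    obtain ⟨N, hN⟩ := hy
    exact ⟨_, hM.mul hN⟩

/-- The scalar that appears as `(HS)³`. -/
def omega : ℂ := ((1 / Real.sqrt 2 : ℝ) : ℂ) * (1 + Complex.I)

theorem omega_sq : omega ^ 2 = Complex.I := by
  have h := inv_sqrt_two_sq
  rw [omega]
  push_cast
  linear_combination (1 + Complex.I) ^ 2 * h + (1 / 2) * Complex.I_sq

theorem H_mul_S_pow_three : H * S * (H * S) * (H * S) = omega • (1 : Mat2) := by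
  have h := inv_sqrt_two_sq
  rw [← one_div] at h
  have h3 : ((1 / Real.sqrt 2 : ℝ) : ℂ) ^ 3 = (1 / 2) * ((1 / Real.sqrt 2 : ℝ) : ℂ) := by
    push_cast
    linear_combination (1 / ((Real.sqrt 2 : ℝ) : ℂ)) * h
  have hT : !![(1 : ℂ), 1; 1, -1] * S * (!![(1 : ℂ), 1; 1, -1] * S) * (!![(1 : ℂ), 1; 1, -1] * S) =
      (2 * (1 + Complex.I)) • (1 : Mat2) := by
    have hI := Complex.I_sq
    ext i j
    fin_cases i <;> fin_cases j <;> simp [S, Matrix.mul_apply, Fin.sum_univ_two] <;> ring_nf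
    all_goals
      simp only [hI]
      ring
  rw [H]
  simp only [Matrix.smul_mul, Matrix.mul_smul, smul_smul, hT]
  congr 1
  rw [omega]
  linear_combination (2 * (1 + Complex.I)) * h3

theorem omega_smul_one_mem_clifford : omega • (1 : Mat4) ∈ clifford := by
  have hH : tensor H 1 ∈ clifford := mem_clifford_of_gate (by simp [cliffordGates])
  have hS : tensor S 1 ∈ clifford := mem_clifford_of_gate (by simp [cliffordGates])
  have h : omega • (1 : Mat4) = tensor H 1 * tensor S 1 * (tensor H 1 * tensor S 1) *
      (tensor H 1 * tensor S 1) := by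
    simp only [tensor_mul_tensor, H_mul_S_pow_three, one_mul, smul_tensor, tensor_one_one]
  rw [h]
  exact mul_mem (mul_mem (mul_mem hH hS) (mul_mem hH hS)) (mul_mem hH hS)

/-- The powers of `omega`, a scalar that comes from `(HS)³`, exhaust the eighth roots of unity:
`key` is the factorisation of `μ ^ 8 - 1` into linear factors. -/
theorem smul_one_mem_clifford {μ : ℂ} (h : μ ^ 8 = 1) : μ • (1 : Mat4) ∈ clifford := by
  have hpow : ∀ n : ℕ, omega ^ n • (1 : Mat4) ∈ clifford := fun n => by
    have := pow_mem omega_smul_one_mem_clifford n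
    rwa [smul_pow, one_pow] at this
  have h2 := omega_sq
  have hI := Complex.I_sq
  have key : (μ - omega ^ 0) * (μ - omega ^ 1) * (μ - omega ^ 2) * (μ - omega ^ 3) *
      (μ - omega ^ 4) * (μ - omega ^ 5) * (μ - omega ^ 6) * (μ - omega ^ 7) = 0 := by
    have h4 : omega ^ 4 = -1 := by
      rw [show omega ^ 4 = (omega ^ 2) ^ 2 by ring, h2, hI]
    have h5 : omega ^ 5 = -omega := by linear_combination omega * h4
    have h6 : omega ^ 6 = -omega ^ 2 := by linear_combination omega ^ 2 * h4
    have h7 : omega ^ 7 = -omega ^ 3 := by linear_combination omega ^ 3 * h4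
    have h3 : omega ^ 3 = Complex.I * omega := by linear_combination omega * h2
    rw [h4, h5, h6, h7, h3, h2]
    have ha : (μ - omega) * (μ + omega) = μ ^ 2 - Complex.I := by linear_combination -h2
    have hb : (μ - Complex.I) * (μ + Complex.I) = μ ^ 2 + 1 := by linear_combination -hI
    have hc : (μ - Complex.I * omega) * (μ + Complex.I * omega) = μ ^ 2 + Complex.I := by
      linear_combination h2 - omega ^ 2 * hI
    calc _ = (μ ^ 2 - 1) * ((μ - omega) * (μ + omega)) * ((μ - Complex.I) * (μ + Complex.I)) *
          ((μ - Complex.I * omega) * (μ + Complex.I * omega)) := by ring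
      _ = 0 := by
        rw [ha, hb, hc]
        linear_combination h - (μ ^ 4 - 1) * hI
  simp only [mul_eq_zero, sub_eq_zero] at key
  rcases key with ((((((h | h) | h) | h) | h) | h) | h) | h <;>
  · rw [h]
    exact hpow _

/-! ### Operators represented by integer matrices -/

/-- The columns `a` and `b` of an operator that scales `e a ∧ e b` lie in the span of `e a`, `e b`. -/
theorem apply_eq_zero_of_wedge {U : Mat4} {c : ℂ} (hc : c ≠ 0) {a b : Fin 4} (hab : a ≠ b)
    (h : ∀ i j, minor U (i, j) (a, b) = if i = a ∧ j = b then c else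
      if i = b ∧ j = a then -c else 0) (i : Fin 4) (hia : i ≠ a) (hib : i ≠ b) :
    U i a = 0 ∧ U i b = 0 := by
  have h1 := h a b
  have h2 := h i a
  have h3 := h i b
  simp only [minor, hia, hib, hab, hab.symm, and_true, and_false, if_true, if_false] at h1 h2 h3
  constructor
  · refine (mul_eq_zero.mp (?_ : c * U i a = 0)).resolve_left hc
    -- This is the expansion of a vanishing determinant of order three: rows `i`, `a`, `b` and
    -- columns `a`, `a`, `b`, the first column being repeated.
    linear_combination (-U i a) * h1 + U a a * h3 - U b a * h2
  · refine (mul_eq_zero.mp (?_ : c * U i b = 0)).resolve_left hc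
    linear_combination (-U i b) * h1 + U a b * h3 - U b b * h2

theorem wedge_e_apply (p : Fin 4 × Fin 4) (i j : Fin 4) : wedge (e p.1) (e p.2) i j =
    (if i = p.1 ∧ j = p.2 then 1 else 0) - if i = p.2 ∧ j = p.1 then 1 else 0 := by
  simp only [wedge, e, Matrix.sub_apply, Matrix.vecMulVec_apply, Pi.single_apply]
  congr 1 <;> split_ifs <;> simp_all

theorem mul_wedge_mul_transpose_apply (U : Mat4) (p : Fin 4 × Fin 4) (i j : Fin 4) :
    (U * wedge (e p.1) (e p.2) * Uᵀ) i j = minor U (i, j) p := by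
  have h := congrFun (congrFun (wedgeAct_wedge U (e p.1) (e p.2)) i) j
  rw [wedgeAct] at h
  rw [h]
  simp [wedge, e, Matrix.vecMulVec_apply, minor, Matrix.col_apply]

/-- An operator whose action on `⋀² ℂ⁴` is diagonal, and scalar on the last five basis vectors, is
a scalar. -/
theorem eq_smul_one_of_wedgeRep {U : Mat4} {c d : ℂ} (hc : c ≠ 0)
    (h : wedgeRep U = c • Matrix.diagonal ![d, 1, 1, 1, 1, 1]) : ∃ μ : ℂ, U = μ • 1 := by
  have hB : ∀ k : Fin 6, k ≠ 0 → U * wedgeBasis k * Uᵀ = c • wedgeBasis k := fun k hk => by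
    rw [← sum_wedgeRep_smul, h, Finset.sum_eq_single k]
    · fin_cases k <;> simp at hk ⊢
    · intro l _ hl
      simp [Matrix.diagonal_apply_ne _ hl]
    · simp
  have hm : ∀ k : Fin 6, k ≠ 0 → ∀ i j, minor U (i, j) (pairP k) +
      pairSign k * minor U (i, j) (pairQ k) = c * (wedge (e (pairP k).1) (e (pairP k).2) i j +
        pairSign k * wedge (e (pairQ k).1) (e (pairQ k).2) i j) := fun k hk i j => by
    have h1 := congrFun (congrFun (hB k hk) i) j
    have hphase : ((Real.sqrt 2 : ℝ) : ℂ)⁻¹ * pairPhase Complex.I k ≠ 0 := by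
      refine mul_ne_zero (inv_ne_zero sqrt_two_ne_zero) ?_
      fin_cases k <;> simp [pairPhase]
    simp only [wedgeBasis_eq, Matrix.mul_smul, Matrix.smul_mul, Matrix.mul_add, Matrix.add_mul,
      Matrix.smul_apply, Matrix.add_apply, smul_eq_mul, mul_wedge_mul_transpose_apply] at h1
    refine mul_left_cancel₀ hphase ?_
    linear_combination h1
  -- Sums and differences of the basis vectors `2, 5` and `3, 4` isolate four coordinate planes,
  -- each of which is therefore scaled by `c`.
  have hw : ∀ p ∈ ([(1, 2), (0, 3), (1, 3), (2, 0)] : List (Fin 4 × Fin 4)), ∀ i j,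
      minor U (i, j) p = c * wedge (e p.1) (e p.2) i j := fun p hp i j => by
    have h2 := hm 2 (by decide) i j
    have h3 := hm 3 (by decide) i j
    have h4 := hm 4 (by decide) i j
    have h5 := hm 5 (by decide) i j
    simp only [pairP, pairQ, pairSign, Matrix.cons_val] at h2 h3 h4 h5
    simp only [List.mem_cons, List.not_mem_nil, or_false] at hp
    rcases hp with rfl | rfl | rfl | rfl
    · linear_combination (h2 + h5) / 2
    · linear_combination (h5 - h2) / 2
    · linear_combination (h3 + h4) / 2
    · linear_combination (h3 - h4) / 2
  have hz : ∀ p ∈ ([(1, 2), (0, 3), (1, 3), (2, 0)] : List (Fin 4 × Fin 4)), ∀ i,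
      i ≠ p.1 → i ≠ p.2 → U i p.1 = 0 ∧ U i p.2 = 0 := fun p hp i => by
    refine apply_eq_zero_of_wedge hc ?_ (fun i j => ?_) i
    · fin_cases hp <;> decide
    · rw [Prod.mk.eta, hw p hp, wedge_e_apply]
      have hne : p.1 ≠ p.2 := by fin_cases hp <;> decide
      split_ifs <;> simp_all
  have hoff : ∀ i a, i ≠ a → U i a = 0 := by
    have h1 := hz (1, 2) (by simp)
    have h2 := hz (0, 3) (by simp)
    have h3 := hz (1, 3) (by simp)
    have h4 := hz (2, 0) (by simp)
    intro i a hia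
    fin_cases i <;> fin_cases a <;> first
      | exact absurd rfl hia
      | exact (h1 _ (by decide) (by decide)).1
      | exact (h1 _ (by decide) (by decide)).2
      | exact (h2 _ (by decide) (by decide)).1
      | exact (h2 _ (by decide) (by decide)).2
      | exact (h3 _ (by decide) (by decide)).1
      | exact (h3 _ (by decide) (by decide)).2
      | exact (h4 _ (by decide) (by decide)).1
      | exact (h4 _ (by decide) (by decide)).2
  have hdiag : ∀ p ∈ ([(1, 2), (0, 3), (1, 3), (2, 0)] : List (Fin 4 × Fin 4)),
      U p.1 p.1 * U p.2 p.2 = c := fun p hp => by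
    have hne : p.1 ≠ p.2 := by fin_cases hp <;> decide
    have h1 := hw p hp p.1 p.2
    rw [minor, wedge_e_apply, hoff p.1 p.2 hne] at h1
    simpa [hne, hne.symm] using h1
  have h12 := hdiag (1, 2) (by simp)
  have h03 := hdiag (0, 3) (by simp)
  have h13 := hdiag (1, 3) (by simp)
  have h20 := hdiag (2, 0) (by simp)
  -- The four planes still permit `diag(a, a, b, b)`. The basis vector of index `1` supplies the
  -- equation that forces `a = b`; that of index `0`, which carries `d`, is never needed.
  have h01 : U 0 0 * U 1 1 = c := by
    have h1 := hm 1 (by decide) 0 1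
    have h2 := wedge_e_apply (0, 1) 0 1
    have h3 := wedge_e_apply (2, 3) 0 1
    simp only [pairP, pairQ, pairSign, Matrix.cons_val, minor, h2, h3] at h1
    simpa [hoff] using h1
  simp only at h12 h03 h13 h20
  have hne : ∀ {x y : ℂ}, x * y = c → x ≠ 0 := fun h hx => hc (by rw [← h, hx, zero_mul])
  have e1 : U 1 1 = U 2 2 :=
    mul_left_cancel₀ (hne h01) (by rw [h01, ← h20, mul_comm])
  have e2 : U 2 2 = U 3 3 := mul_left_cancel₀ (hne h12) (by rw [h12, h13])
  have e3 : U 0 0 = U 1 1 := mul_right_cancel₀ (hne h20) (by rw [h12, mul_comm, h20])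
  refine ⟨U 0 0, ?_⟩
  ext i j
  by_cases hij : i = j
  · subst hij
    fin_cases i <;> simp [e1, e2, e3]
  · simp [hoff i j hij, hij]

/-! ### Signed permutation matrices -/

theorem signedPerm_mul (f g : Equiv.Perm (Fin 6)) (s t : Fin 6 → ℤ) :
    signedPerm f s * signedPerm g t = signedPerm (g * f) fun i => s i * t (f i) := by
  ext i k
  simp only [signedPerm, Matrix.mul_apply, Matrix.of_apply, ite_mul, zero_mul]
  rw [Finset.sum_ite_eq' Finset.univ (f i)]
  simp only [Finset.mem_univ, if_true, mul_ite, mul_zero, Equiv.Perm.mul_apply]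
  congr

theorem signedPerm_one (s : Fin 6 → ℤ) : signedPerm 1 s = Matrix.diagonal s := by
  ext i k
  simp only [signedPerm, Matrix.of_apply, Matrix.diagonal_apply, Equiv.Perm.one_apply, eq_comm]

/-- An integer row of squared length one has a single nonzero entry, `1` or `-1`, and orthogonality
puts the entries of different rows in different columns. -/
theorem exists_signedPerm {M : Matrix (Fin 6) (Fin 6) ℤ} (h : M * Mᵀ = 1) :
    ∃ (f : Equiv.Perm (Fin 6)) (s : Fin 6 → ℤ), (∀ i, s i = 1 ∨ s i = -1) ∧
      M = signedPerm f s := by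
  have hsum : ∀ i, ∑ k, M i k ^ 2 = 1 := fun i => by
    have := congrFun (congrFun h i) i
    simpa [Matrix.mul_apply, sq] using this
  have hex : ∀ i, ∃ k, M i k ≠ 0 := fun i => by
    by_contra! h0
    have := hsum i
    simp [h0] at this
  choose f hf using hex
  have hrest : ∀ i k, k ≠ f i → M i k = 0 := fun i k hk => by
    by_contra h0
    have h1 : M i k ^ 2 + M i (f i) ^ 2 ≤ 1 := by
      rw [← hsum i, ← Finset.sum_pair hk (f := fun k => M i k ^ 2)]
      exact Finset.sum_le_sum_of_subset_of_nonneg (Finset.subset_univ _)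
        fun _ _ _ => sq_nonneg _
    have h2 : 0 < M i k ^ 2 := by positivity
    have h3 : 0 < M i (f i) ^ 2 := by
      have := hf i
      positivity
    omega
  have hone : ∀ i, M i (f i) ^ 2 = 1 := fun i => by
    rw [← hsum i, Finset.sum_eq_single (f i)]
    · intro k _ hk
      simp [hrest i k hk]
    · simp
  have hinj : Function.Injective f := fun i j hij => by
    by_contra hne
    have h1 := congrFun (congrFun h i) j
    rw [Matrix.mul_apply, Finset.sum_eq_single (f i), Matrix.transpose_apply,
      Matrix.one_apply_ne hne] at h1
    · have h2 : M j (f i) ≠ 0 := hij ▸ hf j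
      exact mul_ne_zero (hf i) h2 h1
    · intro k _ hk
      simp [hrest i k hk]
    · simp
  refine ⟨Equiv.ofBijective f (Finite.injective_iff_bijective.mp hinj), fun i => M i (f i),
    fun i => by simpa using hone i, ?_⟩
  ext i k
  simp only [signedPerm, Matrix.of_apply, Equiv.ofBijective_apply]
  split_ifs with hk
  · rw [hk]
  · exact hrest i k hk

/-- The integer matrices that represent Clifford operators. -/
def cliffordReps : Submonoid (Matrix (Fin 6) (Fin 6) ℤ) where
  carrier := {T | ∃ C ∈ clifford, Rep C 0 T}
  one_mem' := ⟨1, one_mem _, Rep.one⟩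
  mul_mem' := by
    rintro _ _ ⟨C, hC, h⟩ ⟨D, hD, h'⟩
    exact ⟨C * D, mul_mem hC hD, h.mul h'⟩

/-- Forgetting signs, the one-qubit gates generate the permutations of `{0, 1, 2}` and of `{3, 4,
5}`, and `CZ` links the two triples. All adjacent transpositions are thus obtained, and they
generate the symmetric group. -/
theorem exists_signedPerm_mem_cliffordReps (f : Equiv.Perm (Fin 6)) :
    ∃ s : Fin 6 → ℤ, (∀ i, s i = 1 ∨ s i = -1) ∧ signedPerm f s ∈ cliffordReps := by
  let P : Submonoid (Equiv.Perm (Fin 6)) :=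
    { carrier := {f | ∃ s : Fin 6 → ℤ, (∀ i, s i = 1 ∨ s i = -1) ∧ signedPerm f s ∈ cliffordReps}
      one_mem' := ⟨1, fun _ => Or.inl rfl, by
        rw [signedPerm_one, Pi.one_def, Matrix.diagonal_one]
        exact one_mem _⟩
      mul_mem' := by
        rintro g f ⟨t, ht, hg⟩ ⟨s, hs, hf⟩
        refine ⟨fun i => s i * t (f i), fun i => ?_, ?_⟩
        · rcases hs i with h1 | h1 <;> rcases ht (f i) with h2 | h2 <;> simp [h1, h2]
        · rw [← signedPerm_mul]
          exact mul_mem hf hg }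
  have hgate : ∀ {g : Mat4} {f : Equiv.Perm (Fin 6)} {s : Fin 6 → ℤ}, g ∈ cliffordGates →
      Rep g 0 (signedPerm f s) → (∀ i, s i = 1 ∨ s i = -1) → f ∈ P := fun hg hr hs =>
    ⟨_, hs, _, mem_clifford_of_gate hg, hr⟩
  have h02 := hgate (by simp [cliffordGates]) rep_H_one (by decide)
  have h35 := hgate (by simp [cliffordGates]) rep_one_H (by decide)
  have h01 := hgate (by simp [cliffordGates]) rep_S_one (by decide)
  have h34 := hgate (by simp [cliffordGates]) rep_one_S (by decide)
  have hCZ := hgate (by simp [cliffordGates]) rep_CZ (by decide)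
  have h25 : Equiv.swap 2 5 ∈ P := by
    have : (Equiv.swap 2 5 : Equiv.Perm (Fin 6)) =
        Equiv.swap 0 1 * (Equiv.swap 0 1 * Equiv.swap 2 5 * Equiv.swap 3 4) * Equiv.swap 3 4 := by
      decide
    rw [this]
    exact mul_mem (mul_mem h01 hCZ) h34
  have key : Submonoid.closure (Set.range fun i : Fin 5 => Equiv.swap i.castSucc i.succ) ≤ P := by
    rw [Submonoid.closure_le]
    rintro _ ⟨i, rfl⟩
    fin_cases i
    · exact h01
    · change Equiv.swap 1 2 ∈ P
      have : (Equiv.swap 1 2 : Equiv.Perm (Fin 6)) =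
        Equiv.swap 0 1 * Equiv.swap 0 2 * Equiv.swap 0 1 := by decide
      exact this.symm ▸ mul_mem (mul_mem h01 h02) h01
    · change Equiv.swap 2 3 ∈ P
      have : (Equiv.swap 2 3 : Equiv.Perm (Fin 6)) =
        Equiv.swap 2 5 * Equiv.swap 3 5 * Equiv.swap 2 5 := by decide
      exact this.symm ▸ mul_mem (mul_mem h25 h35) h25
    · exact h34
    · change Equiv.swap 4 5 ∈ P
      have : (Equiv.swap 4 5 : Equiv.Perm (Fin 6)) =
        Equiv.swap 3 4 * Equiv.swap 3 5 * Equiv.swap 3 4 := by decide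
      exact this.symm ▸ mul_mem (mul_mem h34 h35) h34
  rw [Equiv.Perm.mclosure_swap_castSucc_succ] at key
  exact key (Submonoid.mem_top f)

/-- The diagonal matrix with entry `p` in the positions `0` and `k`, and `1` elsewhere. -/
def flip (k : Fin 6) (p : ℤ) : Matrix (Fin 6) (Fin 6) ℤ :=
  Matrix.diagonal fun i => if i = 0 ∨ i = k then p else 1

theorem transpose_mem_cliffordReps {T : Matrix (Fin 6) (Fin 6) ℤ} (hT : T ∈ cliffordReps) :
    Tᵀ ∈ cliffordReps := by
  obtain ⟨C, hC, h⟩ := hT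
  obtain ⟨D, hD, hCD, -⟩ := exists_inv_mem_clifford hC
  exact ⟨D, hD, h.inv hCD⟩

/-- The square of `tensor S 1` changes the signs at `0` and `1`. Conjugation by a signed permutation
over `swap k 1`, which fixes `0`, moves the second position to `k`. -/
theorem flip_mem_cliffordReps {k : Fin 6} (hk : k ≠ 0) {p : ℤ} (hp : p = 1 ∨ p = -1) :
    flip k p ∈ cliffordReps := by
  rcases hp with rfl | rfl
  · have : flip k 1 = 1 := by simp [flip]
    rw [this]
    exact one_mem _
  · have hS : signedPerm (Equiv.swap 0 1) ![-1, 1, 1, 1, 1, 1] ∈ cliffordReps :=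
      ⟨_, mem_clifford_of_gate (by simp [cliffordGates]), rep_S_one⟩
    have h1 : flip 1 (-1) ∈ cliffordReps := by
      have : flip 1 (-1) = signedPerm (Equiv.swap 0 1) ![-1, 1, 1, 1, 1, 1] *
          signedPerm (Equiv.swap 0 1) ![-1, 1, 1, 1, 1, 1] := by
        decide +kernel
      rw [this]
      exact mul_mem hS hS
    obtain ⟨s, hs, hT⟩ := exists_signedPerm_mem_cliffordReps (Equiv.swap k 1)
    have h2 : flip k (-1) = signedPerm (Equiv.swap k 1) s * flip 1 (-1) *
        (signedPerm (Equiv.swap k 1) s)ᵀ := by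
      have h3 : signedPerm (Equiv.swap k 1) s * (signedPerm (Equiv.swap k 1) s)ᵀ = 1 := by
        obtain ⟨C, -, hC⟩ := hT
        simpa using hC.mul_transpose
      have h4 : signedPerm (Equiv.swap k 1) s * flip 1 (-1) =
          flip k (-1) * signedPerm (Equiv.swap k 1) s := by
        rw [flip, flip, ← signedPerm_one, ← signedPerm_one, signedPerm_mul, signedPerm_mul,
          one_mul, mul_one]
        congr 1
        ext i
        have h5 : ∀ k : Fin 6, k ≠ 0 → ∀ i,
            (Equiv.swap k 1 i = 0 ∨ Equiv.swap k 1 i = 1) ↔ (i = 0 ∨ i = k) := by decide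
        simp only [h5 k hk, Equiv.Perm.one_apply]
        exact mul_comm _ _
      rw [h4, Matrix.mul_assoc, h3, Matrix.mul_one]
    rw [h2]
    exact mul_mem (mul_mem hT h1) (transpose_mem_cliffordReps hT)

theorem exists_diagonal_mem_cliffordReps {u : Fin 6 → ℤ} (hu : ∀ i, u i = 1 ∨ u i = -1) :
    ∃ T ∈ cliffordReps, ∃ d : ℤ, Matrix.diagonal u = T * Matrix.diagonal ![d, 1, 1, 1, 1, 1] := by
  refine ⟨flip 1 (u 1) * flip 2 (u 2) * flip 3 (u 3) * flip 4 (u 4) * flip 5 (u 5), ?_,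
    -- The five flips correct the positions `1` to `5` and leave `u 1 * ⋯ * u 5` at position `0`;
    -- this `d` turns that product into `u 0`.
    u 0 * u 1 * u 2 * u 3 * u 4 * u 5, ?_⟩
  · refine mul_mem (mul_mem (mul_mem (mul_mem ?_ ?_) ?_) ?_) ?_ <;>
      exact flip_mem_cliffordReps (by decide) (hu _)
  · have hs2 : ∀ i, u i * u i = 1 := fun i => by rcases hu i with h | h <;> simp [h]
    simp only [flip, Matrix.diagonal_mul_diagonal]
    congr 1
    ext i
    fin_cases i
    · simp
      linear_combination (-u 0 * (u 2 * u 2 * (u 3 * u 3) * (u 4 * u 4) * (u 5 * u 5))) * hs2 1 -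
        u 0 * (u 3 * u 3 * (u 4 * u 4) * (u 5 * u 5)) * hs2 2 -
        u 0 * (u 4 * u 4 * (u 5 * u 5)) * hs2 3 - u 0 * (u 5 * u 5) * hs2 4 - u 0 * hs2 5
    all_goals simp

/-- An operator that is represented by an integer matrix is a Clifford operator. -/
theorem Rep.mem_clifford {U : Mat4} {M : Matrix (Fin 6) (Fin 6) ℤ} (hU : Rep U 0 M) :
    U ∈ clifford := by
  obtain ⟨f, s, hs, rfl⟩ := exists_signedPerm (by simpa using hU.mul_transpose)
  obtain ⟨t, ht, hT⟩ := exists_signedPerm_mem_cliffordReps f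
  have h1 : signedPerm f s =
      signedPerm f t * Matrix.diagonal fun i => s (f.symm i) * t (f.symm i) := by
    rw [← signedPerm_one, signedPerm_mul]
    have : ∀ i, t i * (s i * t i) = s i := fun i => by rcases ht i with h | h <;> simp [h]
    simp [this]
  obtain ⟨T, hT', d, hd⟩ := exists_diagonal_mem_cliffordReps
    (u := fun i => s (f.symm i) * t (f.symm i)) fun i => by
      rcases hs (f.symm i) with h | h <;> rcases ht (f.symm i) with h' | h' <;> simp [h, h']
  rw [hd, ← Matrix.mul_assoc] at h1
  obtain ⟨C, hC, hCT⟩ := mul_mem hT hT'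
  obtain ⟨D, hD, hCD, hDC⟩ := exists_inv_mem_clifford hC
  have h2 := (hCT.inv hCD).mul hU
  have h3 : (signedPerm f t * T)ᵀ * (signedPerm f t * T) = 1 := by
    rw [mul_eq_one_comm]
    simpa using hCT.mul_transpose
  rw [h1, ← Matrix.mul_assoc, h3, Matrix.one_mul] at h2
  obtain ⟨ε, hε, h4⟩ := h2.exists_phase
  have hε0 : ε ≠ 0 := by
    rintro rfl
    simp at hε
  obtain ⟨μ, hμ⟩ := eq_smul_one_of_wedgeRep (U := D * U) (c := ε⁻¹) (d := d) (inv_ne_zero hε0) (by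
    have h5 : (Matrix.diagonal ![d, 1, 1, 1, 1, 1]).map (Int.cast : ℤ → ℂ) =
        Matrix.diagonal ![(d : ℂ), 1, 1, 1, 1, 1] := by
      rw [Matrix.diagonal_map Int.cast_zero]
      congr 1
      ext i
      fin_cases i <;> simp
    rw [← h5, ← h4, smul_smul]
    simp [hε0])
  -- At exponent `0` the squared determinant is `1`, so the remaining scalar satisfies `μ ^ 8 = 1`.
  -- This is the use of the field `det_sq`.
  have h6 := h2.det_sq
  rw [hμ, Matrix.det_smul, Matrix.det_one, mul_one, Fintype.card_fin, ← pow_mul] at h6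
  have h7 : U = C * (μ • 1) := by rw [← hμ, ← Matrix.mul_assoc, hCD, Matrix.one_mul]
  rw [h7]
  exact mul_mem hC (smul_one_mem_clifford (by simpa using h6))

/-! ### Residues and relations between the generators -/

/-- The residue of an integer matrix modulo two. -/
def res (M : Matrix (Fin 6) (Fin 6) ℤ) : Matrix (Fin 6) (Fin 6) (ZMod 2) :=
  M.map Int.cast

theorem res_apply (M : Matrix (Fin 6) (Fin 6) ℤ) (i j : Fin 6) : res M i j = (M i j : ZMod 2) :=
  rfl

theorem res_neg (M : Matrix (Fin 6) (Fin 6) ℤ) : res (-M) = res M := by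
  ext i j
  simp [res_apply, ZMod.neg_eq_self_mod_two]

theorem partner_ne (j : Fin 15) (i : Fin 6) : partner j i ≠ i := by
  revert j i
  decide

theorem partner_partner (j : Fin 15) (i : Fin 6) : partner j (partner j i) = i := by
  revert j i
  decide

theorem genRep_mul_apply (j : Fin 15) (M : Matrix (Fin 6) (Fin 6) ℤ) (i k : Fin 6) :
    (genRep j * M) i k = M i k + partnerSign j i * M (partner j i) k := by
  have h : ∀ l, genRep j i l * M l k = (if l = i then M l k else 0) +
      if l = partner j i then partnerSign j i * M l k else 0 := fun l => by
    have := partner_ne j i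
    simp only [genRep, Matrix.of_apply]
    split_ifs with h1 h2 <;> simp_all
  rw [Matrix.mul_apply, Finset.sum_congr rfl fun l _ => h l, Finset.sum_add_distrib]
  simp

theorem transpose_genRep_mul_apply (j : Fin 15) (M : Matrix (Fin 6) (Fin 6) ℤ) (i k : Fin 6) :
    ((genRep j)ᵀ * M) i k = M i k - partnerSign j i * M (partner j i) k := by
  have h0 : ∀ (j : Fin 15) (i l : Fin 6), genRep j l i =
      if l = i then 1 else if l = partner j i then -partnerSign j i else 0 := by
    decide +kernel
  have h : ∀ l, (genRep j)ᵀ i l * M l k = (if l = i then M l k else 0) +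
      if l = partner j i then -partnerSign j i * M l k else 0 := fun l => by
    have := partner_ne j i
    rw [Matrix.transpose_apply, h0]
    split_ifs with h1 h2 <;> simp_all
  rw [Matrix.mul_apply, Finset.sum_congr rfl fun l _ => h l, Finset.sum_add_distrib]
  simp [sub_eq_add_neg]

theorem partnerSign_cast (j : Fin 15) (i : Fin 6) : (partnerSign j i : ZMod 2) = 1 := by
  revert j i
  decide

/-- Signs disappear modulo 2, so a generator acts on residues as `1 + σ`, with `σ` its matching. The
transposed generator has the same residue. -/
theorem res_genRep_mul (j : Fin 15) (M : Matrix (Fin 6) (Fin 6) ℤ) (i : Fin 6) :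
    res (genRep j * M) i = res M i + res M (partner j i) := by
  ext k
  rw [res_apply, genRep_mul_apply]
  simp [partnerSign_cast, res_apply]

theorem res_transpose_genRep_mul (j : Fin 15) (M : Matrix (Fin 6) (Fin 6) ℤ) (i : Fin 6) :
    res ((genRep j)ᵀ * M) i = res M i + res M (partner j i) := by
  ext k
  rw [res_apply, transpose_genRep_mul_apply]
  simp [partnerSign_cast, res_apply, ZMod.neg_eq_self_mod_two, sub_eq_add_neg]

theorem add_eq_zero_iff_eq_two {x y : Fin 6 → ZMod 2} : x + y = 0 ↔ x = y := by
  rw [add_eq_zero_iff_eq_neg]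
  constructor <;> intro h <;> ext i <;> have := congrFun h i <;>
    simpa [ZMod.neg_eq_self_mod_two] using this

theorem exists_two_smul {M : Matrix (Fin 6) (Fin 6) ℤ} (h : ∀ i, res M i = 0) :
    ∃ N, M = (2 : ℤ) • N := by
  have h1 : ∀ i j, (2 : ℤ) ∣ M i j := fun i j => by
    have := congrFun (h i) j
    rw [res_apply, Pi.zero_apply] at this
    exact (ZMod.intCast_zmod_eq_zero_iff_dvd _ 2).mp this
  choose N hN using h1
  exact ⟨Matrix.of N, by ext i j; simp [hN]⟩

theorem gen_mul_conjTranspose_gen (j : Fin 15) : gen j * (gen j)ᴴ = 1 :=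
  mul_eq_one_comm.mp (conjTranspose_gen_mul_gen j)

theorem rep_conjTranspose_gen (j : Fin 15) : Rep (gen j)ᴴ 1 (genRep j)ᵀ :=
  (rep_gen j).inv (gen_mul_conjTranspose_gen j)

theorem Rep.mem_clifford_of_res {U : Mat4} {M : Matrix (Fin 6) (Fin 6) ℤ} (hU : Rep U 2 M)
    (h : ∀ i, res M i = 0) : U ∈ clifford := by
  obtain ⟨N, rfl⟩ := exists_two_smul h
  exact hU.half.mem_clifford

/-- Modulo 2, `(1 + σ) ^ 2 = 1 + σ ^ 2 = 0` for an involution `σ`, so the matrix of the square can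
be halved. -/
theorem gen_mul_self_mem_clifford (j : Fin 15) : gen j * gen j ∈ clifford := by
  refine ((rep_gen j).mul (rep_gen j)).mem_clifford_of_res fun i => ?_
  have h1 : ∀ i, res (genRep j) i = res 1 i + res 1 (partner j i) := fun i => by
    rw [← res_genRep_mul, Matrix.mul_one]
  rw [res_genRep_mul, h1, h1, partner_partner, add_eq_zero_iff_eq_two]
  exact add_comm _ _

/-- Permuting the six indices permutes the matchings of the generators. -/
theorem exists_partner_conj (f : Equiv.Perm (Fin 6)) (j : Fin 15) :
    ∃ j', ∀ i, f (partner j' i) = partner j (f i) := by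
  let P : Submonoid (Equiv.Perm (Fin 6)) :=
    { carrier := {f | ∀ j, ∃ j', ∀ i, f (partner j' i) = partner j (f i)}
      one_mem' := fun j => ⟨j, fun _ => rfl⟩
      mul_mem' := by
        intro f g hf hg j
        obtain ⟨j', h⟩ := hf j
        obtain ⟨j'', h'⟩ := hg j'
        exact ⟨j'', fun i => by rw [Equiv.Perm.mul_apply, h', h, Equiv.Perm.mul_apply]⟩ }
  have key : Submonoid.closure (Set.range fun i : Fin 5 => Equiv.swap i.castSucc i.succ) ≤ P := by
    rw [Submonoid.closure_le]
    rintro _ ⟨i, rfl⟩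
    change ∀ j, ∃ j', ∀ l, Equiv.swap i.castSucc i.succ (partner j' l) =
      partner j (Equiv.swap i.castSucc i.succ l)
    revert i
    -- The property is closed under composition, so adjacent transpositions suffice and the check
    -- avoids all 720 permutations.
    decide +kernel
  rw [Equiv.Perm.mclosure_swap_castSucc_succ] at key
  exact key (Submonoid.mem_top f) j

theorem res_signedPerm {f : Equiv.Perm (Fin 6)} {s : Fin 6 → ℤ} (hs : ∀ i, s i = 1 ∨ s i = -1)
    (M : Matrix (Fin 6) (Fin 6) ℤ) (i : Fin 6) : res (signedPerm f s * M) i = res M (f i) := by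
  ext k
  have h : (signedPerm f s * M) i k = s i * M (f i) k := by
    simp only [signedPerm, Matrix.mul_apply, Matrix.of_apply, ite_mul, zero_mul]
    rw [Finset.sum_ite_eq' Finset.univ (f i)]
    simp
  rw [res_apply, h, res_apply]
  rcases hs i with h | h <;> simp [h, ZMod.neg_eq_self_mod_two]

/-- When the permutation of `C` carries the matching of `j'` to that of `j`, the residue of `(gen
j')ᴴ * C * gen j` is a permutation matrix times `(1 + σ) ^ 2 = 0`; halving then yields a Clifford
operator. -/
theorem exists_clifford_mul_gen {T : Matrix (Fin 6) (Fin 6) ℤ} {C : Mat4} {f : Equiv.Perm (Fin 6)}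
    {s : Fin 6 → ℤ} (hs : ∀ i, s i = 1 ∨ s i = -1) (hC : Rep C 0 T) (hT : T = signedPerm f s)
    {j j' : Fin 15} (hj : ∀ i, f (partner j' i) = partner j (f i)) :
    ∃ D ∈ clifford, C * gen j = gen j' * D := by
  refine ⟨(gen j')ᴴ * (C * gen j), ?_, ?_⟩
  · have h := (rep_conjTranspose_gen j').mul (hC.mul (rep_gen j))
    refine h.mem_clifford_of_res fun i => ?_
    have h1 : ∀ i, res (genRep j) i = res 1 i + res 1 (partner j i) := fun i => by
      rw [← res_genRep_mul, Matrix.mul_one]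
    rw [hT, res_transpose_genRep_mul, res_signedPerm hs, res_signedPerm hs, h1, h1, hj,
      partner_partner, add_eq_zero_iff_eq_two]
    exact add_comm _ _
  · rw [← Matrix.mul_assoc, gen_mul_conjTranspose_gen, Matrix.one_mul]

theorem exists_gen_mul {C : Mat4} (hC : C ∈ clifford) (j : Fin 15) :
    ∃ j', ∃ D ∈ clifford, C * gen j = gen j' * D := by
  obtain ⟨T, hT⟩ := exists_rep_of_mem_clifford hC
  obtain ⟨f, s, hs, hM⟩ := exists_signedPerm (by simpa using hT.mul_transpose)
  obtain ⟨j', hj'⟩ := exists_partner_conj f j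
  exact ⟨j', exists_clifford_mul_gen hs hT hM hj'⟩

theorem CS_eq_gen : CS = gen 2 := by
  have h := four_smul_gen 2
  have h2 : (4 : ℂ) • CS = (gaussGen 2).map GaussianInt.toComplex := by
    have h3 : gaussGen 2 = Matrix.diagonal ![4, 4, 4, ⟨0, 4⟩] := by decide +kernel
    rw [h3, CS]
    ext i j
    fin_cases i <;> fin_cases j <;> simp [GaussianInt.toComplex_def]
  exact smul_right_injective Mat4 (by norm_num : (4 : ℂ) ≠ 0) (h2.trans h.symm)

theorem mem_cliffordCS_of_mem_clifford {C : Mat4} (hC : C ∈ clifford) : C ∈ cliffordCS :=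
  Submonoid.closure_mono (Set.subset_insert _ _) hC

theorem gen_mem_cliffordCS (j : Fin 15) : gen j ∈ cliffordCS := by
  -- Two transpositions suffice to carry any of the fifteen matchings to the matching of `CS`, which
  -- is `gen 2`.
  have h : ∀ j, ∃ a b c d : Fin 6, ∀ i, (Equiv.swap a b * Equiv.swap c d) (partner j i) =
      partner 2 ((Equiv.swap a b * Equiv.swap c d) i) := by
    decide +kernel
  obtain ⟨a, b, c, d, h⟩ := h j
  obtain ⟨s, hs, C, hC, hT⟩ :=
    exists_signedPerm_mem_cliffordReps (Equiv.swap a b * Equiv.swap c d)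
  obtain ⟨D, hD, hCD⟩ := exists_clifford_mul_gen hs hT rfl h
  obtain ⟨D', hD', hDD', -⟩ := exists_inv_mem_clifford hD
  have h2 : gen j = C * CS * D' := by
    rw [CS_eq_gen, hCD, Matrix.mul_assoc, hDD', Matrix.mul_one]
  rw [h2]
  exact mul_mem (mul_mem (mem_cliffordCS_of_mem_clifford hC)
    (Submonoid.subset_closure (Set.mem_insert _ _))) (mem_cliffordCS_of_mem_clifford hD')

/-- The action of a scaled generator on a vector. -/
def genAct (j : Fin 15) (v : Fin 6 → ℤ) : Fin 6 → ℤ :=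
  fun i => v i + partnerSign j i * v (partner j i)

/-- The action of the transpose of a scaled generator on a vector. -/
def genActTranspose (j : Fin 15) (v : Fin 6 → ℤ) : Fin 6 → ℤ :=
  fun i => v i - partnerSign j i * v (partner j i)

-- The finite check behind the exchange relation. Four generators give exponent `4`, and
-- divisibility by `4` brings it to `0`. The product is applied to basis vectors through the
-- matchings, which replaces multiplication of matrices by cheap evaluations.
set_option maxRecDepth 10000 in
theorem exists_four_dvd : ∀ r s t : Fin 15,
    (∃ i, partner r i = partner s i ∧ partner s i = partner t i) → r ≠ s → s ≠ t →
    ∃ x, ∀ i k, (genActTranspose x (genActTranspose r (genAct s (genAct t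
      fun l => if l = k then 1 else 0)))) i % 4 = 0 := by
  decide +kernel

/-- Two generators can be exchanged for two others whose patterns share the same block. -/
theorem exists_exchange {r s t : Fin 15}
    (h : ∃ i, partner r i = partner s i ∧ partner s i = partner t i) (hrs : r ≠ s) (hst : s ≠ t) :
    ∃ x, ∃ D ∈ clifford, (gen r)ᴴ * (gen s * gen t) = gen x * D := by
  obtain ⟨x, hx⟩ := exists_four_dvd r s t h hrs hst
  refine ⟨x, (gen x)ᴴ * ((gen r)ᴴ * (gen s * gen t)), ?_, ?_⟩
  · have h1 := (rep_conjTranspose_gen x).mul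
      ((rep_conjTranspose_gen r).mul ((rep_gen s).mul (rep_gen t)))
    have h2 : ∀ i k, (4 : ℤ) ∣
        ((genRep x)ᵀ * ((genRep r)ᵀ * (genRep s * genRep t))) i k := fun i k => by
      have h3 := hx i k
      have h4 : ∀ l, (genAct t fun l => if l = k then 1 else 0) l = genRep t l k := fun l => by
        have := genRep_mul_apply t 1 l k
        rw [Matrix.mul_one] at this
        rw [this]
        simp only [genAct, Matrix.one_apply]
      simp only [genActTranspose, genAct] at h3 h4
      simp only [h4, ← genRep_mul_apply, ← transpose_genRep_mul_apply] at h3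
      exact Int.dvd_of_emod_eq_zero h3
    choose N hN using h2
    have h5 : (genRep x)ᵀ * ((genRep r)ᵀ * (genRep s * genRep t)) =
        (2 : ℤ) • ((2 : ℤ) • Matrix.of N) := by
      ext i k
      rw [hN]
      simp
      ring
    rw [h5] at h1
    exact (Rep.half (n := 0) (Rep.half (n := 2) h1)).mem_clifford
  · rw [← Matrix.mul_assoc (gen x), gen_mul_conjTranspose_gen, Matrix.one_mul]

/-! ### Row types -/

/-- The smaller index of a pair of indices. -/
def pairFst : Fin 15 → Fin 6 := ![0, 0, 0, 0, 0, 1, 1, 1, 1, 2, 2, 2, 3, 3, 4]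

/-- The larger index of a pair of indices. -/
def pairSnd : Fin 15 → Fin 6 := ![1, 2, 3, 4, 5, 2, 3, 4, 5, 3, 4, 5, 4, 5, 5]

/-- The row patterns that occur: six different rows, the pattern of a generator, or a pair of equal
rows and four other equal rows. -/
abbrev RowType := Option (Fin 15 ⊕ Fin 15)

/-- A function on the row indices whose fibres are the blocks of the pattern. -/
def color : RowType → Fin 6 → Fin 6
  | none, i => i
  | some (Sum.inl s), i => min i (partner s i)
  | some (Sum.inr p), i => if i = pairFst p ∨ i = pairSnd p then 0 else 1

/-- The pattern of the generator refines the row pattern. -/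
def Refines (s : Fin 15) (τ : RowType) : Prop := ∀ i, color τ (partner s i) = color τ i

instance (s : Fin 15) (τ : RowType) : Decidable (Refines s τ) :=
  inferInstanceAs (Decidable (∀ i, color τ (partner s i) = color τ i))

/-- The row pattern of the product of a generator and a matrix, if the pattern of the generator does
not refine that of the matrix. -/
def nextType (s : Fin 15) : RowType → RowType
  | none => some (Sum.inl s)
  | some (Sum.inl t) =>
    match (List.finRange 15).find? fun p =>
      partner s (pairFst p) = pairSnd p ∧ partner t (pairFst p) = pairSnd p with
    | some p => some (Sum.inr p)
    | none => some (Sum.inl s)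
  | some (Sum.inr q) =>
    match (List.finRange 15).find? fun p =>
      partner s (pairFst p) = pairSnd p ∧ pairFst p ≠ pairFst q ∧ pairFst p ≠ pairSnd q ∧
        pairSnd p ≠ pairFst q ∧ pairSnd p ≠ pairSnd q with
    | some p => some (Sum.inr p)
    | none => some (Sum.inl s)

theorem nextType_ne_none (s : Fin 15) (τ : RowType) : nextType s τ ≠ none := by
  revert s τ
  decide +kernel

theorem refines_nextType (s : Fin 15) (τ : RowType) : Refines s (nextType s τ) := by
  revert s τ
  decide +kernel

theorem not_refines_none (s : Fin 15) : ¬ Refines s none := by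
  revert s
  decide

/-- The left side lists the three ways in which the sums of rows `i, σ i` and rows `j, σ j` agree
when these sums have no accidental coincidence; `nextType` records the resulting pattern. -/
theorem color_nextType_iff : ∀ (s : Fin 15) (τ : RowType), τ ≠ none → ¬ Refines s τ → ∀ i j,
    (color τ i = color τ (partner s i) ∧ color τ j = color τ (partner s j) ∨
      color τ i = color τ j ∧ color τ (partner s i) = color τ (partner s j) ∨
      color τ i = color τ (partner s j) ∧ color τ (partner s i) = color τ j) ↔
    color (nextType s τ) i = color (nextType s τ) j := by
  decide +kernel

/-- Supplies the hypothesis of `add_eq_add_iff_zmod_two`. It fails for six distinct rows, which is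
why the innermost letter of a word is treated apart, in `hasType_genRep_mul`. -/
theorem color_not_injective : ∀ (s : Fin 15) (τ : RowType), τ ≠ none → ∀ i j,
    color τ i = color τ (partner s i) ∨ color τ j = color τ (partner s j) ∨
      color τ i = color τ j ∨ color τ (partner s i) = color τ (partner s j) ∨
      color τ i = color τ (partner s j) ∨ color τ (partner s i) = color τ j := by
  decide +kernel

/-- A pattern that is a matching is refined only by itself. A pair with a quadruple is refined by
the three matchings containing that pair, and the relevant ones share this block with some `t`
refining the old pattern, as `exists_exchange` requires. -/
theorem refines_nextType_cases : ∀ (s : Fin 15) (τ : RowType), ¬ Refines s τ → ∀ r,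
    Refines r (nextType s τ) → r = s ∨ ∃ t, Refines t τ ∧ r ≠ s ∧ s ≠ t ∧
      ∃ i, partner r i = partner s i ∧ partner s i = partner t i := by
  decide +kernel

/-- The rows of the residue of `M` have the given pattern. -/
def HasType (τ : RowType) (M : Matrix (Fin 6) (Fin 6) ℤ) : Prop :=
  ∀ i j, res M i = res M j ↔ color τ i = color τ j

theorem add_self_zmod_two (x : Fin 6 → ZMod 2) : x + x = 0 :=
  add_eq_zero_iff_eq_two.mpr rfl

/-- Without a coincidence among the four vectors, two sums could agree accidentally; with one,
cancellation leaves only the listed cases. -/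
theorem add_eq_add_iff_zmod_two {x y z w : Fin 6 → ZMod 2}
    (h : x = y ∨ z = w ∨ x = z ∨ y = w ∨ x = w ∨ y = z) :
    x + y = z + w ↔ x = y ∧ z = w ∨ x = z ∧ y = w ∨ x = w ∧ y = z := by
  constructor
  · intro h1
    rcases h with rfl | rfl | rfl | rfl | rfl | rfl
    · rw [add_self_zmod_two, eq_comm, add_eq_zero_iff_eq_two] at h1
      exact Or.inl ⟨rfl, h1⟩
    · rw [add_self_zmod_two, add_eq_zero_iff_eq_two] at h1
      exact Or.inl ⟨h1, rfl⟩
    · exact Or.inr (Or.inl ⟨rfl, add_left_cancel h1⟩)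
    · exact Or.inr (Or.inl ⟨add_right_cancel h1, rfl⟩)
    · rw [add_comm] at h1
      exact Or.inr (Or.inr ⟨rfl, add_right_cancel h1⟩)
    · rw [add_comm] at h1
      exact Or.inr (Or.inr ⟨add_left_cancel h1, rfl⟩)
  · rintro (⟨rfl, rfl⟩ | ⟨rfl, rfl⟩ | ⟨rfl, rfl⟩)
    · rw [add_self_zmod_two, add_self_zmod_two]
    · rfl
    · exact add_comm _ _

theorem HasType.genRep_mul {s : Fin 15} {τ : RowType} {M : Matrix (Fin 6) (Fin 6) ℤ}
    (hM : HasType τ M) (hτ : τ ≠ none) (hs : ¬ Refines s τ) :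
    HasType (nextType s τ) (genRep s * M) := by
  intro i j
  rw [res_genRep_mul, res_genRep_mul, ← color_nextType_iff s τ hτ hs i j,
    add_eq_add_iff_zmod_two]
  · simp only [hM _ _]
  · simp only [hM _ _]
    exact color_not_injective s τ hτ i j

theorem res_signedPerm_one {f : Equiv.Perm (Fin 6)} {s : Fin 6 → ℤ}
    (hs : ∀ i, s i = 1 ∨ s i = -1) (i k : Fin 6) :
    res (signedPerm f s) i k = if k = f i then 1 else 0 := by
  have h := congrFun (res_signedPerm (f := f) hs 1 i) k
  rw [Matrix.mul_one] at h
  rw [h, res_apply, Matrix.one_apply]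
  by_cases hk : k = f i
  · simp [hk]
  · simp [hk, Ne.symm hk]

theorem hasType_none {M : Matrix (Fin 6) (Fin 6) ℤ} (h : M * Mᵀ = 1) : HasType none M := by
  obtain ⟨f, s, hs, rfl⟩ := exists_signedPerm h
  intro i j
  refine ⟨fun hij => ?_, fun hij => by rw [show i = j from hij]⟩
  have h1 := congrFun hij (f i)
  rw [res_signedPerm_one hs, res_signedPerm_one hs, if_pos rfl] at h1
  by_contra hne
  have hne' : f i ≠ f j := fun h2 => hne (f.injective h2)
  rw [if_neg hne'] at h1
  exact one_ne_zero h1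

/-- Here the rows of `M` are, modulo 2, six distinct unit vectors, so `r i + r (σ i)` determines the
block `{i, σ i}`. -/
theorem hasType_genRep_mul {M : Matrix (Fin 6) (Fin 6) ℤ} (h : M * Mᵀ = 1) (t : Fin 15) :
    HasType (nextType t none) (genRep t * M) := by
  obtain ⟨f, s, hs, rfl⟩ := exists_signedPerm h
  have hc : ∀ (t : Fin 15) i j, color (nextType t none) i = color (nextType t none) j ↔
      i = j ∨ i = partner t j := by
    decide +kernel
  intro i j
  rw [hc, res_genRep_mul, res_genRep_mul]
  constructor
  · intro h1
    have h2 := congrFun h1 (f i)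
    simp only [Pi.add_apply, res_signedPerm_one hs, if_true, f.injective.eq_iff] at h2
    rw [if_neg fun h3 => partner_ne t i h3.symm] at h2
    by_contra! h3
    rw [if_neg h3.1, if_neg h3.2] at h2
    simp at h2
  · rintro (rfl | rfl)
    · rfl
    · rw [partner_partner, add_comm]

/-! ### Words in the generators -/

/-- The product of a word in the generators. -/
def wordProd (l : List (Fin 15)) : Mat4 := (l.map gen).prod

/-- The row pattern of the product of a word. -/
def rowType : List (Fin 15) → RowType
  | [] => none
  | s :: l => nextType s (rowType l)

/-- No letter of the word lowers the least denominator exponent of the product of the later ones. -/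
def Reduced : List (Fin 15) → Prop
  | [] => True
  | s :: l => Reduced l ∧ ¬ Refines s (rowType l)

theorem wordProd_cons_mul (s : Fin 15) (l : List (Fin 15)) (C : Mat4) :
    wordProd (s :: l) * C = gen s * (wordProd l * C) := by
  rw [wordProd, List.map_cons, List.prod_cons, Matrix.mul_assoc]
  rfl

theorem Reduced.exists_rep {l : List (Fin 15)} (hl : Reduced l) {C : Mat4} (hC : C ∈ clifford) :
    ∃ M, Rep (wordProd l * C) l.length M ∧ HasType (rowType l) M := by
  obtain ⟨T, hT⟩ := exists_rep_of_mem_clifford hC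
  have hT1 : T * Tᵀ = 1 := by simpa using hT.mul_transpose
  induction l with
  | nil => exact ⟨T, by simpa [wordProd] using hT, hasType_none hT1⟩
  | cons s l ih =>
    obtain ⟨M, hM, hM'⟩ := ih hl.1
    rw [wordProd_cons_mul, List.length_cons, add_comm]
    refine ⟨_, (rep_gen s).mul hM, ?_⟩
    cases l with
    | nil => exact hasType_genRep_mul (by simpa using hM.mul_transpose) s
    | cons t l => exact hM'.genRep_mul (nextType_ne_none _ _) hl.2

/-- The operator is the product of a word of length at most `n` and a Clifford operator. -/
def IsWord (n : ℕ) (U : Mat4) : Prop :=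
  ∃ l : List (Fin 15), l.length ≤ n ∧ ∃ C ∈ clifford, U = wordProd l * C

theorem IsWord.mono {m n : ℕ} {U : Mat4} (h : IsWord m U) (hmn : m ≤ n) : IsWord n U := by
  obtain ⟨l, hl, h⟩ := h
  exact ⟨l, hl.trans hmn, h⟩

theorem IsWord.gen_mul {n : ℕ} {U : Mat4} (h : IsWord n U) (s : Fin 15) :
    IsWord (n + 1) (gen s * U) := by
  obtain ⟨l, hl, C, hC, rfl⟩ := h
  exact ⟨s :: l, by simpa using hl, C, hC, (wordProd_cons_mul s l C).symm⟩

/-- A Clifford operator moves to the right through each generator by `exists_gen_mul`, which may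
change the letters but not their number. -/
theorem IsWord.clifford_mul {n : ℕ} {U D : Mat4} (h : IsWord n U) (hD : D ∈ clifford) :
    IsWord n (D * U) := by
  obtain ⟨l, hl, C, hC, rfl⟩ := h
  refine IsWord.mono ?_ hl
  clear hl
  induction l generalizing D with
  | nil => exact ⟨[], le_rfl, D * C, mul_mem hD hC, by simp [wordProd]⟩
  | cons s l ih =>
    obtain ⟨t, E, hE, h⟩ := exists_gen_mul hD s
    rw [wordProd_cons_mul, ← Matrix.mul_assoc, h, Matrix.mul_assoc]
    exact (ih hE).gen_mul t

theorem conjTranspose_gen_mul_gen_mul (s : Fin 15) (U : Mat4) : (gen s)ᴴ * (gen s * U) = U := by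
  rw [← Matrix.mul_assoc, conjTranspose_gen_mul_gen, Matrix.one_mul]

theorem gen_mul_conjTranspose_gen_mul (s : Fin 15) (U : Mat4) : gen s * ((gen s)ᴴ * U) = U := by
  rw [← Matrix.mul_assoc, gen_mul_conjTranspose_gen, Matrix.one_mul]

/-- If `r` is the first letter `s`, it cancels. Otherwise some `t` refines the pattern of the tail
`w` and shares a block with `r` and `s`; then `r† s w = (r† s t) (t† w) = x D (t† w)`, and `t† w` is
shorter than `w` by induction. -/
theorem Reduced.isWord_conjTranspose_gen_mul {l : List (Fin 15)} (hl : Reduced l) {C : Mat4}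
    (hC : C ∈ clifford) {r : Fin 15} (hr : Refines r (rowType l)) :
    IsWord (l.length - 1) ((gen r)ᴴ * (wordProd l * C)) := by
  induction l generalizing r with
  | nil => exact absurd hr (not_refines_none r)
  | cons s l ih =>
    rw [wordProd_cons_mul, List.length_cons, Nat.add_sub_cancel]
    obtain rfl | ⟨t, ht, hrs, hst, h⟩ := refines_nextType_cases s _ hl.2 r hr
    · rw [conjTranspose_gen_mul_gen_mul]
      exact ⟨l, le_rfl, C, hC, rfl⟩
    · obtain ⟨x, D, hD, hx⟩ := exists_exchange h hrs hst
      have h1 : (gen r)ᴴ * (gen s * (wordProd l * C)) =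
          gen x * (D * ((gen t)ᴴ * (wordProd l * C))) := by
        rw [← Matrix.mul_assoc (gen x), ← hx, Matrix.mul_assoc, Matrix.mul_assoc,
          gen_mul_conjTranspose_gen_mul]
      rw [h1]
      -- The bound obtained is `l.length - 1 + 1`, which equals `l.length` only for nonempty `l`.
      -- The empty tail is excluded because no matching refines six distinct rows.
      refine (((ih hl.1 ht).clifford_mul hD).gen_mul x).mono ?_
      cases l with
      | nil => exact absurd ht (not_refines_none t)
      | cons => simp

/-- Since `r = r² r†` and `r²` is Clifford, multiplying by `r` shortens the word just as multiplying
by `r†` does. -/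
theorem Reduced.isWord_gen_mul_of_refines {l : List (Fin 15)} (hl : Reduced l) {C : Mat4}
    (hC : C ∈ clifford) {r : Fin 15} (hr : Refines r (rowType l)) :
    IsWord (l.length - 1) (gen r * (wordProd l * C)) := by
  have h := (hl.isWord_conjTranspose_gen_mul hC hr).clifford_mul (gen_mul_self_mem_clifford r)
  rwa [Matrix.mul_assoc, gen_mul_conjTranspose_gen_mul] at h

theorem IsWord.exists_reduced {n : ℕ} {U : Mat4} (h : IsWord n U) :
    ∃ l, Reduced l ∧ l.length ≤ n ∧ ∃ C ∈ clifford, U = wordProd l * C := by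
  induction n using Nat.strong_induction_on generalizing U with
  | _ n ih =>
    obtain ⟨l, hl, C, hC, rfl⟩ := h
    cases l with
    | nil => exact ⟨[], trivial, hl, C, hC, rfl⟩
    | cons s l =>
      have hn : l.length < n := hl
      obtain ⟨l', hl', hlen, D, hD, h⟩ := ih l.length hn ⟨l, le_rfl, C, hC, rfl⟩
      rw [wordProd_cons_mul, h]
      by_cases hs : Refines s (rowType l')
      · obtain ⟨l'', h1, h2, h3⟩ :=
          ih (l'.length - 1) (by omega) (hl'.isWord_gen_mul_of_refines hD hs)
        exact ⟨l'', h1, by omega, h3⟩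
      · exact ⟨s :: l', ⟨hl', hs⟩, by simp only [List.length_cons]; omega, D, hD,
          (wordProd_cons_mul s l' D).symm⟩

theorem exists_isWord {U : Mat4} (hU : U ∈ cliffordCS) : ∃ n, IsWord n U := by
  induction hU using Submonoid.closure_induction_left with
  | one => exact ⟨0, [], le_rfl, 1, one_mem _, by simp [wordProd]⟩
  | mul_left g hg y _ ih =>
    obtain ⟨n, hn⟩ := ih
    rcases hg with rfl | hg
    · exact ⟨n + 1, CS_eq_gen ▸ hn.gen_mul 2⟩
    · exact ⟨n, hn.clifford_mul (mem_clifford_of_gate hg)⟩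

theorem wordProd_mul_mem_cliffordCS (l : List (Fin 15)) {C : Mat4} (hC : C ∈ clifford) :
    wordProd l * C ∈ cliffordCS := by
  refine mul_mem (Submonoid.list_prod_mem _ fun x hx => ?_) (mem_cliffordCS_of_mem_clifford hC)
  obtain ⟨j, -, rfl⟩ := List.mem_map.mp hx
  exact gen_mem_cliffordCS j

/-! ### Least denominator exponents -/

/-- A smaller exponent would make every entry of `N` an integer multiplied by a positive power of
`√2`. Squaring removes the root and shows each entry to be even. -/
theorem le_of_isDenominatorExponent {V : Matrix (Fin 6) (Fin 6) ℂ} {n ℓ : ℕ}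
    {N : Matrix (Fin 6) (Fin 6) ℤ}
    (hN : ((Real.sqrt 2 : ℝ) : ℂ) ^ n • V = N.map (Int.cast : ℤ → ℂ))
    (h : ∃ i k, res N i k ≠ 0) (hℓ : IsDenominatorExponent V ℓ) : n ≤ ℓ := by
  obtain ⟨M, hM⟩ := hℓ
  obtain ⟨i, k, hik⟩ := h
  by_contra! hlt
  obtain ⟨d, rfl⟩ := Nat.exists_eq_add_of_lt hlt
  have h1 := congrFun (congrFun hN i) k
  have h2 := congrFun (congrFun hM i) k
  simp only [Matrix.smul_apply, smul_eq_mul, Matrix.map_apply] at h1 h2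
  have h3 : ((N i k : ℤ) : ℂ) = ((Real.sqrt 2 : ℝ) : ℂ) ^ (d + 1) * (M i k : ℂ) := by
    rw [← h1, ← h2]
    ring
  have h4 : ((N i k : ℤ) : ℂ) ^ 2 = 2 ^ (d + 1) * (M i k : ℂ) ^ 2 := by
    rw [h3, mul_pow, ← pow_mul, mul_comm (d + 1), pow_mul, sqrt_two_sq]
  have h5 : N i k ^ 2 = 2 ^ (d + 1) * M i k ^ 2 := by exact_mod_cast h4
  have h6 : (2 : ℤ) ∣ N i k :=
    Int.prime_two.dvd_of_dvd_pow ⟨2 ^ d * M i k ^ 2, by rw [h5]; ring⟩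
  exact hik ((ZMod.intCast_zmod_eq_zero_iff_dvd _ 2).mpr h6)

theorem lde_eq {V : Matrix (Fin 6) (Fin 6) ℂ} {n : ℕ} {N : Matrix (Fin 6) (Fin 6) ℤ}
    (hN : ((Real.sqrt 2 : ℝ) : ℂ) ^ n • V = N.map (Int.cast : ℤ → ℂ))
    (h : ∃ i k, res N i k ≠ 0) : lde V = n := by
  have hmem : n ∈ {ℓ | IsDenominatorExponent V ℓ} := ⟨N, hN⟩
  exact le_antisymm (Nat.sInf_le hmem)
    (le_of_isDenominatorExponent hN h (Nat.sInf_mem ⟨n, hmem⟩))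

theorem HasType.exists_res_ne_zero {τ : RowType} {M : Matrix (Fin 6) (Fin 6) ℤ}
    (h : HasType τ M) : ∃ i k, res M i k ≠ 0 := by
  have hτ : ∀ τ, ∃ i j, color τ i ≠ color τ j := by decide +kernel
  obtain ⟨i, j, hij⟩ := hτ τ
  by_contra! h0
  exact hij ((h i j).mp (by ext k; rw [h0, h0]))

theorem Rep.lde_so6 {U : Mat4} {n : ℕ} {M : Matrix (Fin 6) (Fin 6) ℤ} (hU : Rep U n M)
    (h : ∃ i k, res M i k ≠ 0) : lde (so6 U) = n := by
  obtain ⟨N, rfl | rfl, hN⟩ := hU.exists_so6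
  · exact lde_eq hN h
  · exact lde_eq hN (by rwa [res_neg])

theorem Reduced.lde_so6 {l : List (Fin 15)} (hl : Reduced l) {C : Mat4} (hC : C ∈ clifford) :
    lde (so6 (wordProd l * C)) = l.length := by
  obtain ⟨M, hM, h⟩ := hl.exists_rep hC
  exact hM.lde_so6 h.exists_res_ne_zero

theorem IsWord.lde_so6_le {n : ℕ} {U : Mat4} (h : IsWord n U) : lde (so6 U) ≤ n := by
  obtain ⟨l, hl, hn, C, hC, rfl⟩ := h.exists_reduced
  rwa [hl.lde_so6 hC]

theorem isDenominatorExponent_neg {V : Matrix (Fin 6) (Fin 6) ℂ} {ℓ : ℕ}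
    (h : IsDenominatorExponent V ℓ) : IsDenominatorExponent (-V) ℓ := by
  obtain ⟨M, hM⟩ := h
  refine ⟨-M, ?_⟩
  rw [smul_neg, hM]
  ext i j
  simp

theorem lde_neg (V : Matrix (Fin 6) (Fin 6) ℂ) : lde (-V) = lde V := by
  have : ∀ ℓ, IsDenominatorExponent (-V) ℓ ↔ IsDenominatorExponent V ℓ := fun ℓ =>
    ⟨fun h => neg_neg V ▸ isDenominatorExponent_neg h, isDenominatorExponent_neg⟩
  simp only [lde, this]

/-- Up to a sign, `(so6 (gen j))ᵀ * so6 U` is the matrix of `(gen j)ᴴ * U`. -/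
theorem exists_transpose_so6_gen_mul {U : Mat4} {n : ℕ} {M : Matrix (Fin 6) (Fin 6) ℤ}
    (hU : Rep U n M) (j : Fin 15) :
    ∃ N, (N = (genRep j)ᵀ * M ∨ N = -((genRep j)ᵀ * M)) ∧
      ((Real.sqrt 2 : ℝ) : ℂ) ^ (1 + n) • ((so6 (gen j))ᵀ * so6 U) =
        N.map (Int.cast : ℤ → ℂ) := by
  obtain ⟨A, hA, hA'⟩ := (rep_gen j).exists_so6
  obtain ⟨B, hB, hB'⟩ := hU.exists_so6
  refine ⟨Aᵀ * B, ?_, ?_⟩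
  · rcases hA with rfl | rfl <;> rcases hB with rfl | rfl <;>
      simp [Matrix.transpose_neg]
  · have h1 : Aᵀ.map (Int.cast : ℤ → ℂ) = (A.map Int.cast)ᵀ := rfl
    rw [map_intCast_mul, h1, ← hA', ← hB', Matrix.transpose_smul, smul_mul_smul_comm, pow_add]

/-- The map `so6` is controlled only up to sign, because of its choice of a root of the determinant;
the exponent does not see this sign. -/
theorem lde_transpose_so6_gen_mul {U : Mat4} {n : ℕ} {M : Matrix (Fin 6) (Fin 6) ℤ}
    (hU : Rep U n M) (j : Fin 15) :
    lde ((so6 (gen j))ᵀ * so6 U) = lde (so6 ((gen j)ᴴ * U)) := by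
  obtain ⟨A, hA, hA'⟩ := exists_transpose_so6_gen_mul hU j
  obtain ⟨B, hB, hB'⟩ := ((rep_conjTranspose_gen j).mul hU).exists_so6
  have hs : ((Real.sqrt 2 : ℝ) : ℂ) ^ (1 + n) ≠ 0 := pow_ne_zero _ sqrt_two_ne_zero
  have hneg : ∀ A : Matrix (Fin 6) (Fin 6) ℤ,
      (-A).map (Int.cast : ℤ → ℂ) = -A.map (Int.cast : ℤ → ℂ) := fun A => by
    ext a b
    simp
  have hAB : B = A ∨ B = -A := by
    rcases hA with rfl | rfl <;> rcases hB with rfl | rfl <;> simp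
  rcases hAB with rfl | rfl
  · rw [smul_right_injective _ hs (hA'.trans hB'.symm)]
  · rw [hneg, ← hA', ← smul_neg] at hB'
    rw [smul_right_injective _ hs hB', lde_neg]

/-- A generator lowers the least denominator exponent if and only if its pattern refines the row
pattern. -/
theorem Reduced.reduces_iff {l : List (Fin 15)} (hl : Reduced l) {k : ℕ} (hk : l.length = k + 1)
    {C : Mat4} (hC : C ∈ clifford) (j : Fin 15) :
    Reduces (wordProd l * C) k j ↔ Refines j (rowType l) := by
  obtain ⟨M, hM, hM'⟩ := hl.exists_rep hC
  constructor
  · intro h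
    obtain ⟨N, hN, hN'⟩ := exists_transpose_so6_gen_mul hM j
    have h1 : IsDenominatorExponent ((so6 (gen j))ᵀ * so6 (wordProd l * C)) k := by
      have h2 := Nat.sInf_mem
        (s := {ℓ | IsDenominatorExponent ((so6 (gen j))ᵀ * so6 (wordProd l * C)) ℓ}) ⟨_, N, hN'⟩
      rwa [show sInf _ = k from h] at h2
    -- The scaling exponent of `N` is `k + 2`, so one odd entry would exclude the exponent `k`.
    -- Evenness of `N` says exactly that matched rows of `M` agree modulo 2.
    have h2 : ∀ i c, res N i c = 0 := by
      by_contra! h2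
      have := le_of_isDenominatorExponent hN' h2 h1
      omega
    have h3 : res N = res ((genRep j)ᵀ * M) := by
      rcases hN with rfl | rfl
      · rfl
      · exact res_neg _
    rw [h3] at h2
    intro i
    rw [← hM', eq_comm, ← add_eq_zero_iff_eq_two, ← res_transpose_genRep_mul]
    ext c
    exact h2 i c
  · intro h
    have h1 := (hl.isWord_conjTranspose_gen_mul hC h).lde_so6_le
    rw [hk, Nat.add_sub_cancel] at h1
    rw [Reduces, lde_transpose_so6_gen_mul hM]
    refine le_antisymm h1 ?_
    obtain ⟨n, hn⟩ : ∃ n, n = lde (so6 ((gen j)ᴴ * (wordProd l * C))) := ⟨_, rfl⟩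
    obtain ⟨l', hl', hlen, D, hD, h3⟩ :=
      (hl.isWord_conjTranspose_gen_mul hC h).exists_reduced
    -- The exponent cannot fall below `k`: restoring `gen j` would give a word with fewer than `k +
    -- 1` letters for an operator of exponent `k + 1`.
    have h4 : IsWord (l'.length + 1) (wordProd l * C) := by
      rw [← gen_mul_conjTranspose_gen_mul j (wordProd l * C), h3]
      exact IsWord.gen_mul ⟨l', le_rfl, D, hD, rfl⟩ j
    have h5 := h4.lde_so6_le
    rw [hl.lde_so6 hC] at h5
    rw [h3, hl'.lde_so6 hD]
    omega

/-! ### Normal forms -/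

theorem normalForm_of_lde_eq_zero {U : Mat4} (h : lde (so6 U) = 0) : normalForm U = [U] := by
  rw [normalForm, h, synthesize]

theorem normalForm_of_reduces {U : Mat4} {k : ℕ} (hk : lde (so6 U) = k + 1) {j : Fin 15}
    (hj : Reduces U k j) (hmin : ∀ i, Reduces U k i → j ≤ i)
    (hlde : lde (so6 ((gen j)ᴴ * U)) = k) :
    normalForm U = gen j :: normalForm ((gen j)ᴴ * U) := by
  classical
  have hex : ∃ j, Reduces U k j := ⟨j, hj⟩
  rw [normalForm, hk, synthesize, dif_pos hex]
  have hfind : Fin.find (Reduces U k) hex = j := by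
    rw [Fin.find_eq_iff]
    exact ⟨hj, fun i hi h => absurd (hmin i h) (not_le.mpr hi)⟩
  rw [normalForm, hlde]
  congr!

/-- Every letter is the generator of lowest index that lowers the least denominator exponent. -/
def IsNormal : List (Fin 15) → Prop
  | [] => True
  | s :: l => IsNormal l ∧ ¬ Refines s (rowType l) ∧ ∀ r, Refines r (nextType s (rowType l)) → s ≤ r

theorem IsNormal.reduced {l : List (Fin 15)} (hl : IsNormal l) : Reduced l := by
  induction l with
  | nil => trivial
  | cons s l ih => exact ⟨ih hl.1, hl.2.1⟩

theorem IsNormal.normalForm_eq {l : List (Fin 15)} (hl : IsNormal l) {C : Mat4}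
    (hC : C ∈ clifford) : normalForm (wordProd l * C) = l.map gen ++ [C] := by
  induction l with
  | nil =>
    have h := hl.reduced.lde_so6 hC
    rw [normalForm_of_lde_eq_zero h]
    simp [wordProd]
  | cons s l ih =>
    have h1 := hl.reduced.reduces_iff (k := l.length) rfl hC
    have h2 : (gen s)ᴴ * (wordProd (s :: l) * C) = wordProd l * C := by
      rw [wordProd_cons_mul, conjTranspose_gen_mul_gen_mul]
    rw [normalForm_of_reduces (hl.reduced.lde_so6 hC) ((h1 s).mpr (refines_nextType _ _))
      (fun i hi => hl.2.2 i ((h1 i).mp hi)) (by rw [h2, hl.1.reduced.lde_so6 hC]), h2, ih hl.1]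
    rfl

/-- Strip from a reduced word the lowest refining generator `j` and recurse. In front of the normal
word so obtained, `j` cannot refine the tail pattern, since the product would then have too small an
exponent. -/
theorem exists_isNormal {U : Mat4} (hU : U ∈ cliffordCS) :
    ∃ l, IsNormal l ∧ ∃ C ∈ clifford, U = wordProd l * C := by
  obtain ⟨n, hn⟩ := exists_isWord hU
  induction n using Nat.strong_induction_on generalizing U with
  | _ n ih =>
    obtain ⟨l, hl, hlen, C, hC, rfl⟩ := hn.exists_reduced
    cases l with
    | nil => exact ⟨[], trivial, C, hC, rfl⟩
    | cons s l =>
      have hex : ∃ j, Refines j (rowType (s :: l)) := ⟨s, refines_nextType _ _⟩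
      obtain ⟨j, hj, hmin⟩ : ∃ j, Refines j (rowType (s :: l)) ∧
          ∀ r, Refines r (rowType (s :: l)) → j ≤ r :=
        ⟨Fin.find _ hex, Fin.find_spec hex, fun r hr => Fin.find_le_of_pos hex hr⟩
      have h1 := hl.isWord_conjTranspose_gen_mul hC hj
      have h2 : (gen j)ᴴ * (wordProd (s :: l) * C) ∈ cliffordCS := by
        obtain ⟨l', -, D, hD, h⟩ := h1
        exact h ▸ wordProd_mul_mem_cliffordCS l' hD
      simp only [List.length_cons, Nat.add_sub_cancel] at h1 hlen
      obtain ⟨l', hl', D, hD, h3⟩ := ih l.length (by omega) h2 h1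
      have h4 : wordProd (s :: l) * C = wordProd (j :: l') * D := by
        rw [wordProd_cons_mul j, ← h3, gen_mul_conjTranspose_gen_mul]
      have h5 : l'.length ≤ l.length := by
        rw [← hl'.reduced.lde_so6 hD, ← h3]
        exact h1.lde_so6_le
      have h6 := hl.lde_so6 hC
      have h7 : ¬ Refines j (rowType l') := fun h => by
        have h8 := (hl'.reduced.isWord_gen_mul_of_refines hD h).lde_so6_le
        rw [← wordProd_cons_mul, ← h4, h6, List.length_cons] at h8
        omega
      have hred : Reduced (j :: l') := ⟨hl'.reduced, h7⟩
      have h8 : l'.length = l.length := by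
        have := hred.lde_so6 hD
        rw [← h4, h6] at this
        simpa using this.symm
      refine ⟨j :: l', ⟨hl', h7, fun r hr => hmin r ?_⟩, D, hD, h4⟩
      -- `Refines` is read off a word, while `Reduces` depends only on the operator, so minimality
      -- passes from the old word to the new one.
      rw [← hl.reduces_iff (k := l.length) rfl hC, h4,
        hred.reduces_iff (k := l.length) (by simp [h8]) hD]
      exact hr

theorem mem_normalForms_iff (w : List Mat4) :
    w ∈ normalForms ↔ ∃ l, IsNormal l ∧ ∃ C ∈ clifford, w = l.map gen ++ [C] := by
  constructor
  · rintro ⟨U, hU, rfl⟩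
    obtain ⟨l, hl, C, hC, rfl⟩ := exists_isNormal hU
    exact ⟨l, hl, C, hC, hl.normalForm_eq hC⟩
  · rintro ⟨l, hl, C, hC, rfl⟩
    exact ⟨wordProd l * C, wordProd_mul_mem_cliffordCS l hC, hl.normalForm_eq hC⟩

theorem mem_alphabet_of_mem_normalForm {U : Mat4} (hU : U ∈ cliffordCS) {a : Mat4}
    (ha : a ∈ normalForm U) : a ∈ alphabet := by
  obtain ⟨l, hl, C, hC, rfl⟩ := exists_isNormal hU
  rw [hl.normalForm_eq hC, List.mem_append, List.mem_map, List.mem_singleton] at ha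
  rcases ha with ⟨j, -, rfl⟩ | rfl
  · exact Or.inl ⟨j, rfl⟩
  · exact Or.inr hC

/-! ### Patterns of the generators -/

/-- The patterns of two generators have no common block. -/
def DisjointPatterns (s t : Fin 15) : Prop := ∀ i, partner s i ≠ partner t i

instance (s t : Fin 15) : Decidable (DisjointPatterns s t) :=
  inferInstanceAs (Decidable (∀ i, partner s i ≠ partner t i))

theorem residue_eq_res {V : Matrix (Fin 6) (Fin 6) ℂ} {n : ℕ} {N : Matrix (Fin 6) (Fin 6) ℤ}
    (hN : ((Real.sqrt 2 : ℝ) : ℂ) ^ n • V = N.map (Int.cast : ℤ → ℂ)) : residue n V = res N := by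
  ext i j
  have h : ((Real.sqrt 2 : ℝ) : ℂ) ^ n * V i j = (N i j : ℂ) := congrFun (congrFun hN i) j
  rw [residue, Matrix.of_apply, h, Complex.intCast_re, Int.floor_intCast, res_apply]

theorem pattern_so6_gen (s : Fin 15) :
    pattern (so6 (gen s)) = Set.range fun i => {i, partner s i} := by
  have hM : HasType (some (Sum.inl s)) (genRep s) := by
    simpa [nextType] using hasType_genRep_mul (M := 1) (by simp) s
  have hlde : lde (so6 (gen s)) = 1 := (rep_gen s).lde_so6 hM.exists_res_ne_zero
  have hres : residue 1 (so6 (gen s)) = res (genRep s) := by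
    obtain ⟨N, rfl | rfl, hN⟩ := (rep_gen s).exists_so6
    · exact residue_eq_res hN
    · rw [residue_eq_res hN, res_neg]
  have hc : ∀ (t : Fin 15) i j, color (some (Sum.inl t)) i = color (some (Sum.inl t)) j ↔
      i = j ∨ i = partner t j := by
    decide +kernel
  have hker : ∀ i, {x | Setoid.ker (fun i => res (genRep s) i) x i} = {i, partner s i} := by
    intro i
    ext x
    rw [Set.mem_ofPred_eq, Setoid.ker_def, hM x i, hc]
    rfl
  rw [pattern, hlde, hres]
  ext B
  simp only [Setoid.classes, Set.mem_ofPred_eq, hker, Set.mem_range, eq_comm]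

/-- All blocks are pairs, so a common block amounts to one index with the same partner in both
matchings. -/
theorem pattern_inter_pattern_eq_empty_iff (s t : Fin 15) :
    pattern (so6 (gen s)) ∩ pattern (so6 (gen t)) = ∅ ↔ DisjointPatterns s t := by
  rw [pattern_so6_gen, pattern_so6_gen, ← not_iff_not, ← ne_eq, ← Set.nonempty_iff_ne_empty,
    DisjointPatterns]
  push Not
  constructor
  · rintro ⟨B, ⟨i, rfl⟩, j, hj⟩
    have hj' : ({j, partner t j} : Set (Fin 6)) = {i, partner s i} := hj
    have h1 : i = j ∨ i = partner t j := by
      have : i ∈ ({j, partner t j} : Set (Fin 6)) := hj' ▸ Set.mem_insert _ _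
      exact this
    have h2 : partner s i = j ∨ partner s i = partner t j := by
      have : partner s i ∈ ({j, partner t j} : Set (Fin 6)) :=
        hj' ▸ Set.mem_insert_of_mem _ rfl
      exact this
    have h3 := partner_ne s i
    refine ⟨i, ?_⟩
    rcases h1 with rfl | h1
    · rcases h2 with h2 | h2
      · exact absurd h2 h3
      · exact h2
    · rcases h2 with h2 | h2
      · rw [h2, h1, partner_partner]
      · exact absurd (h2.trans h1.symm) h3
  · rintro ⟨i, hi⟩
    exact ⟨{i, partner s i}, ⟨i, rfl⟩, i, by simp only [hi]⟩

/-! ### Acceptance from a state -/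

/-- The automaton accepts the word when it starts in the given state. -/
inductive Acc {α σ : Type} (A : εNFA α σ) : σ → List α → Prop
  | nil (q : σ) : q ∈ A.accept → Acc A q []
  | eps (q t : σ) (w : List α) : t ∈ A.step q none → Acc A t w → Acc A q w
  | cons (q t : σ) (a : α) (w : List α) : t ∈ A.step q (some a) → Acc A t w → Acc A q (a :: w)

section Acc

variable {α σ τ : Type}

/-- `Acc` consumes the word from the front and hides the `ε`-labels of paths, which makes induction
along a run direct. -/
theorem mem_accepts_iff_acc (A : εNFA α σ) (w : List α) :
    w ∈ A.accepts ↔ ∃ q ∈ A.start, Acc A q w := by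
  rw [εNFA.mem_accepts_iff_exists_path]
  constructor
  · rintro ⟨q, f, x, hq, hf, rfl, hx⟩
    refine ⟨q, hq, ?_⟩
    clear hq
    induction hx with
    | nil s => exact Acc.nil s hf
    | cons t s u a x hst _ ih =>
      cases a with
      | none =>
        rw [List.reduceOption_cons_of_none]
        exact Acc.eps _ _ _ hst (ih hf)
      | some a =>
        rw [List.reduceOption_cons_of_some]
        exact Acc.cons _ _ _ _ hst (ih hf)
  · rintro ⟨q, hq, h⟩
    suffices h : ∃ f x, f ∈ A.accept ∧ x.reduceOption = w ∧ A.IsPath q f x by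
      obtain ⟨f, x, hf, hx, hp⟩ := h
      exact ⟨q, f, x, hq, hf, hx, hp⟩
    clear hq
    induction h with
    | nil q hq => exact ⟨q, [], hq, rfl, εNFA.IsPath.nil q⟩
    | eps q t w ht _ ih =>
      obtain ⟨f, x, hf, hx, hp⟩ := ih
      exact ⟨f, none :: x, hf, by rw [List.reduceOption_cons_of_none, hx],
        εNFA.IsPath.cons _ _ _ _ _ ht hp⟩
    | cons q t a w ht _ ih =>
      obtain ⟨f, x, hf, hx, hp⟩ := ih
      exact ⟨f, some a :: x, hf, by rw [List.reduceOption_cons_of_some, hx],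
        εNFA.IsPath.cons _ _ _ _ _ ht hp⟩

theorem acc_concat_inr (A : εNFA α σ) (B : εNFA α τ) (q : τ) (w : List α) :
    Acc (concat A B) (Sum.inr q) w ↔ Acc B q w := by
  constructor
  · intro h
    generalize hp : (Sum.inr q : σ ⊕ τ) = p at h
    induction h generalizing q with
    | nil p h =>
      subst hp
      obtain ⟨q', hq', h⟩ := h
      cases h
      exact Acc.nil _ hq'
    | eps p t w ht _ ih =>
      subst hp
      obtain ⟨t', ht', rfl⟩ := ht
      exact Acc.eps _ _ _ ht' (ih t' rfl)
    | cons p t a w ht _ ih =>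
      subst hp
      obtain ⟨t', ht', rfl⟩ := ht
      exact Acc.cons _ _ _ _ ht' (ih t' rfl)
  · intro h
    induction h with
    | nil q h => exact Acc.nil _ ⟨q, h, rfl⟩
    | eps q t w ht _ ih => exact Acc.eps _ _ _ ⟨t, ht, rfl⟩ ih
    | cons q t a w ht _ ih => exact Acc.cons _ _ _ _ ⟨t, ht, rfl⟩ ih

theorem acc_concat_inl (A : εNFA α σ) (B : εNFA α τ) (q : σ) (w : List α) :
    Acc (concat A B) (Sum.inl q) w ↔
      ∃ u v, Acc A q u ∧ (∃ s ∈ B.start, Acc B s v) ∧ u ++ v = w := by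
  constructor
  · intro h
    generalize hp : (Sum.inl q : σ ⊕ τ) = p at h
    induction h generalizing q with
    | nil p h =>
      subst hp
      obtain ⟨q', hq', h⟩ := h
      cases h
    | eps p t w ht hw ih =>
      subst hp
      rcases ht with ⟨t', ht', rfl⟩ | ⟨-, hq, s, hs, rfl⟩
      · obtain ⟨u, v, hu, hv, rfl⟩ := ih t' rfl
        exact ⟨u, v, Acc.eps _ _ _ ht' hu, hv, rfl⟩
      · exact ⟨[], w, Acc.nil _ hq, ⟨s, hs, (acc_concat_inr A B s w).mp hw⟩, rfl⟩
    | cons p t a w ht hw ih =>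
      subst hp
      rcases ht with ⟨t', ht', rfl⟩ | ⟨h, -⟩
      · obtain ⟨u, v, hu, hv, rfl⟩ := ih t' rfl
        exact ⟨a :: u, v, Acc.cons _ _ _ _ ht' hu, hv, rfl⟩
      · cases h
  · rintro ⟨u, v, hu, ⟨s, hs, hv⟩, rfl⟩
    induction hu with
    | nil q h =>
      exact Acc.eps _ (Sum.inr s) _ (Or.inr ⟨rfl, h, s, hs, rfl⟩) ((acc_concat_inr A B s v).mpr hv)
    | eps q t w ht _ ih => exact Acc.eps _ (Sum.inl t) _ (Or.inl ⟨t, ht, rfl⟩) ih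
    | cons q t a w ht _ ih => exact Acc.cons _ (Sum.inl t) _ _ (Or.inl ⟨t, ht, rfl⟩) ih

theorem accepts_concat (A : εNFA α σ) (B : εNFA α τ) :
    (concat A B).accepts = A.accepts * B.accepts := by
  ext w
  rw [mem_accepts_iff_acc, Language.mem_mul]
  simp only [mem_accepts_iff_acc]
  constructor
  · rintro ⟨_, ⟨q, hq, rfl⟩, h⟩
    obtain ⟨u, v, hu, hv, rfl⟩ := (acc_concat_inl A B q w).mp h
    exact ⟨u, ⟨q, hq, hu⟩, v, hv, rfl⟩
  · rintro ⟨u, ⟨q, hq, hu⟩, v, hv, rfl⟩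
    exact ⟨Sum.inl q, ⟨q, hq, rfl⟩, (acc_concat_inl A B q _).mpr ⟨u, v, hu, hv, rfl⟩⟩

end Acc

theorem mem_accepts_cliffordAutomaton (w : List alphabet) :
    w ∈ cliffordAutomaton.accepts ↔ ∃ C ∈ clifford, w.map Subtype.val = [C] := by
  rw [mem_accepts_iff_acc]
  constructor
  · rintro ⟨q, hq, h⟩
    obtain rfl : q = none := hq
    cases h with
    | nil _ h => exact absurd rfl h
    | eps _ _ _ ht _ => cases ht
    | cons _ t a w ht hw =>
      obtain ⟨C, hC, rfl⟩ := ht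
      cases hw with
      | nil => exact ⟨C, C.2, by simp [hC]⟩
      | eps _ _ _ ht _ => cases ht
      | cons _ _ _ _ ht _ => cases ht
  · rintro ⟨C, hC, hw⟩
    obtain ⟨a, rfl, ha⟩ := List.map_eq_singleton_iff.mp hw
    refine ⟨none, rfl, Acc.cons _ (some ⟨C, hC⟩) _ _ ⟨⟨C, hC⟩, ha, rfl⟩ (Acc.nil _ ?_)⟩
    exact Option.some_ne_none _

/-- The words of generators that are accepted from a state of `genAutomaton n m` when this automaton
is followed by one that accepts the words of generators with the property `Q`. -/
def AccFrom (m : ℕ) (hm : m ≤ 15) (Q : List (Fin 15) → Prop) : Fin m → List (Fin 15) → Prop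
  | _, [] => Q []
  | s, a :: l => Q (a :: l) ∨ a = s.castLE hm ∧
      ∃ t : Fin m, DisjointPatterns (s.castLE hm) (t.castLE hm) ∧ AccFrom m hm Q t l

theorem AccFrom.of_prop {m : ℕ} {hm : m ≤ 15} {Q : List (Fin 15) → Prop} {l : List (Fin 15)}
    (h : Q l) (s : Fin m) : AccFrom m hm Q s l := by
  cases l with
  | nil => exact h
  | cons a l => exact Or.inl h

/-- The word consists of a word of generators with the property `Q` and a Clifford operator. -/
def HasForm (Q : List (Fin 15) → Prop) (w : List alphabet) : Prop :=
  ∃ l, Q l ∧ ∃ C ∈ clifford, w.map Subtype.val = l.map gen ++ [C]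

/-- Every state of the generator automaton is final, so control may pass to `B` at any moment; this
is the alternative `Q` in `AccFrom`. -/
theorem acc_concat_genAutomaton {τ : Type} (n m : ℕ) (hm : m ≤ 15) (B : εNFA alphabet τ)
    (Q : List (Fin 15) → Prop) (hB : ∀ w, w ∈ B.accepts ↔ HasForm Q w) (s : Fin m)
    (w : List alphabet) :
    Acc (concat (genAutomaton n m hm) B) (Sum.inl s) w ↔ HasForm (AccFrom m hm Q s) w := by
  constructor
  · intro h
    generalize hp : (Sum.inl s : Fin m ⊕ τ) = p at h
    induction h generalizing s with
    | nil p h =>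
      subst hp
      obtain ⟨q', hq', h⟩ := h
      cases h
    | eps p t w ht hw ih =>
      subst hp
      rcases ht with ⟨t', ht', rfl⟩ | ⟨-, hq, s', hs, rfl⟩
      · cases ht'
      · obtain ⟨l, hl, h⟩ :=
          (hB w).mp ((mem_accepts_iff_acc B w).mpr ⟨s', hs, (acc_concat_inr _ B s' w).mp hw⟩)
        exact ⟨l, AccFrom.of_prop hl s, h⟩
    | cons p t a w ht hw ih =>
      subst hp
      rcases ht with ⟨t', ⟨ha, ht'⟩, rfl⟩ | ⟨h, -⟩
      · obtain ⟨l, hl, C, hC, h⟩ := ih t' rfl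
        rw [pattern_inter_pattern_eq_empty_iff] at ht'
        exact ⟨s.castLE hm :: l, Or.inr ⟨rfl, t', ht', hl⟩, C, hC, by simp [h, ha]⟩
      · cases h
  · rintro ⟨l, hl, C, hC, h⟩
    have hstart : ∀ {l w}, Q l → w.map Subtype.val = l.map gen ++ [C] → ∀ s : Fin m,
        Acc (concat (genAutomaton n m hm) B) (Sum.inl s) w := fun {l w} hQ hw s => by
      obtain ⟨t, ht, hacc⟩ := (mem_accepts_iff_acc B w).mp ((hB w).mpr ⟨l, hQ, C, hC, hw⟩)
      exact Acc.eps _ (Sum.inr t) _ (Or.inr ⟨rfl, trivial, t, ht, rfl⟩)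
        ((acc_concat_inr _ B t w).mpr hacc)
    induction l generalizing s w with
    | nil => exact hstart hl h s
    | cons b l ih =>
      rcases hl with hl | ⟨rfl, t, hst, hl⟩
      · exact hstart hl h s
      · cases w with
        | nil => simp at h
        | cons a w =>
          simp only [List.map_cons, List.cons_append, List.cons.injEq] at h
          exact Acc.cons _ (Sum.inl t) _ _
            (Or.inl ⟨t, ⟨h.1, (pattern_inter_pattern_eq_empty_iff _ _).mpr hst⟩, rfl⟩)
            (ih t w hl h.2)

theorem mem_accepts_concat_genAutomaton {τ : Type} (n m : ℕ) (hm : m ≤ 15) (B : εNFA alphabet τ)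
    (Q : List (Fin 15) → Prop) (hB : ∀ w, w ∈ B.accepts ↔ HasForm Q w) (w : List alphabet) :
    w ∈ (concat (genAutomaton n m hm) B).accepts ↔
      HasForm (fun l => ∃ s : Fin m, n ≤ (s : ℕ) + 1 ∧ AccFrom m hm Q s l) w := by
  rw [mem_accepts_iff_acc]
  constructor
  · rintro ⟨_, ⟨s, hs, rfl⟩, h⟩
    obtain ⟨l, hl, h⟩ := (acc_concat_genAutomaton n m hm B Q hB s w).mp h
    exact ⟨l, ⟨s, hs, hl⟩, h⟩
  · rintro ⟨l, ⟨s, hs, hl⟩, h⟩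
    exact ⟨Sum.inl s, ⟨s, hs, rfl⟩, (acc_concat_genAutomaton n m hm B Q hB s w).mpr ⟨l, hl, h⟩⟩

/-! ### Comparison with the normal forms -/

/-- A normal word whose product has the row pattern `τ` can be extended by the letter `s`. -/
def Extends (s : Fin 15) (τ : RowType) : Prop :=
  ¬ Refines s τ ∧ ∀ r, Refines r (nextType s τ) → s ≤ r

instance (s : Fin 15) (τ : RowType) : Decidable (Extends s τ) :=
  inferInstanceAs (Decidable (¬ Refines s τ ∧ ∀ r, Refines r (nextType s τ) → s ≤ r))

/-- Induction on the word with `P τ s` as invariant: acceptance from `s` depends on a normal word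
only through its pattern `τ`. What remains is `hstep`, a statement about single letters, patterns
and states, decidable in each application. -/
theorem accFrom_iff {m : ℕ} {hm : m ≤ 15} {Q : List (Fin 15) → Prop} {Q' : RowType → Prop}
    {P : RowType → Fin m → Prop} (hQ : ∀ l, Q l ↔ IsNormal l ∧ Q' (rowType l)) (hQ' : Q' none)
    (hP : ∀ s, P none s)
    (hstep : ∀ (a : Fin 15) (τ : RowType) (s : Fin m),
      Extends a τ ∧ Q' (nextType a τ) ∨ (a = s.castLE hm ∧
        ∃ t : Fin m, DisjointPatterns (s.castLE hm) (t.castLE hm) ∧ P τ t) ↔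
      Extends a τ ∧ P (nextType a τ) s)
    (s : Fin m) (l : List (Fin 15)) :
    AccFrom m hm Q s l ↔ IsNormal l ∧ P (rowType l) s := by
  induction l generalizing s with
  | nil =>
    rw [AccFrom, hQ]
    exact ⟨fun h => ⟨h.1, hP s⟩, fun h => ⟨h.1, hQ'⟩⟩
  | cons a l ih =>
    have h1 := hstep a (rowType l) s
    have h2 : IsNormal (a :: l) ↔ IsNormal l ∧ Extends a (rowType l) := Iff.rfl
    rw [AccFrom, hQ, h2, rowType]
    simp only [ih]
    constructor
    · rintro (⟨⟨h3, h4⟩, h5⟩ | ⟨rfl, t, ht, h3, h4⟩)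
      · have := h1.mp (Or.inl ⟨h4, h5⟩)
        exact ⟨⟨h3, this.1⟩, this.2⟩
      · have := h1.mp (Or.inr ⟨rfl, t, ht, h4⟩)
        exact ⟨⟨h3, this.1⟩, this.2⟩
    · rintro ⟨⟨h3, h4⟩, h5⟩
      rcases h1.mpr ⟨h4, h5⟩ with h6 | ⟨rfl, t, ht, h6⟩
      · exact Or.inl ⟨⟨h3, h6.1⟩, h6.2⟩
      · exact Or.inr ⟨rfl, t, ht, h3, h6⟩

/-- The states of the last part from which the normal words with row pattern `τ` are accepted. -/
def LastState : RowType → Fin 15 → Bool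
  | none, _ => true
  | some (Sum.inl t), s => s = t
  | some (Sum.inr _), _ => false

/-- The states of the middle part from which the normal words with row pattern `τ` are accepted. -/
def MiddleState : RowType → Fin 9 → Bool
  | none, _ => true
  | some (Sum.inl t), s => 9 ≤ t ∨ s.castLE (by norm_num) = t
  | some (Sum.inr p), s => Refines (s.castLE (by norm_num)) (some (Sum.inr p)) ∧
      ∀ r, Refines r (some (Sum.inr p)) → r = s.castLE (by norm_num) ∨ 9 ≤ r

/-- The states of the first part from which the normal words with row pattern `τ` are accepted. -/
def FirstState : RowType → Fin 3 → Bool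
  | none, _ => true
  | some (Sum.inl t), s => 3 ≤ t ∨ s.castLE (by norm_num) = t
  | some (Sum.inr p), s => (∀ r, Refines r (some (Sum.inr p)) → 3 ≤ r) ∨
      Refines (s.castLE (by norm_num)) (some (Sum.inr p))

theorem isNormal_iff (l : List (Fin 15)) : IsNormal l ↔
    ∃ s : Fin 3, 1 ≤ (s : ℕ) + 1 ∧ AccFrom 3 (by norm_num) (fun l =>
      ∃ s : Fin 9, 4 ≤ (s : ℕ) + 1 ∧ AccFrom 9 (by norm_num) (fun l =>
        ∃ s : Fin 15, 10 ≤ (s : ℕ) + 1 ∧ AccFrom 15 le_rfl (fun l => l = []) s l) s l) s l := by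
  -- The parts are treated from the innermost outwards; the condition found for each part becomes
  -- `Q'` for the part in front of it.
  have h3 := accFrom_iff (m := 15) (hm := le_rfl) (Q := fun l => l = [])
    (Q' := fun τ => τ = none) (P := fun τ s => LastState τ s) (fun l => by
      cases l with
      | nil => exact ⟨fun _ => ⟨trivial, rfl⟩, fun _ => rfl⟩
      | cons a l => exact ⟨fun h => (List.cons_ne_nil _ _ h).elim,
          fun h => (nextType_ne_none _ _ h.2).elim⟩) rfl (fun _ => rfl) (by decide +kernel)
  have h2 := accFrom_iff (m := 9) (hm := by norm_num)
    (Q := fun l => ∃ s : Fin 15, 10 ≤ (s : ℕ) + 1 ∧ AccFrom 15 le_rfl (fun l => l = []) s l)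
    (Q' := fun τ => ∃ s : Fin 15, 10 ≤ (s : ℕ) + 1 ∧ LastState τ s)
    (P := fun τ s => MiddleState τ s) (fun l => by
      simp only [h3]
      constructor
      · rintro ⟨s, hs, hl, h⟩
        exact ⟨hl, s, hs, h⟩
      · rintro ⟨hl, s, hs, h⟩
        exact ⟨s, hs, hl, h⟩) (by decide +kernel) (fun _ => rfl) (by decide +kernel)
  have h1 := accFrom_iff (m := 3) (hm := by norm_num)
    (Q := fun l => ∃ s : Fin 9, 4 ≤ (s : ℕ) + 1 ∧ AccFrom 9 (by norm_num) (fun l =>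
        ∃ s : Fin 15, 10 ≤ (s : ℕ) + 1 ∧ AccFrom 15 le_rfl (fun l => l = []) s l) s l)
    (Q' := fun τ => ∃ s : Fin 9, 4 ≤ (s : ℕ) + 1 ∧ MiddleState τ s)
    (P := fun τ s => FirstState τ s) (fun l => by
      simp only [h2]
      constructor
      · rintro ⟨s, hs, hl, h⟩
        exact ⟨hl, s, hs, h⟩
      · rintro ⟨hl, s, hs, h⟩
        exact ⟨s, hs, hl, h⟩) (by decide +kernel) (fun _ => rfl) (by decide +kernel)
  simp only [h1]
  -- Every pattern has an admissible initial state, so no normal word is missed and the condition on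
  -- states disappears.
  have h0 : ∀ τ, ∃ s : Fin 3, 1 ≤ (s : ℕ) + 1 ∧ FirstState τ s := by decide +kernel
  constructor
  · intro hl
    obtain ⟨s, hs, h⟩ := h0 (rowType l)
    exact ⟨s, hs, hl, h⟩
  · rintro ⟨s, -, hl, -⟩
    exact hl

theorem mem_accepts_normalFormAutomaton (w : List alphabet) :
    w ∈ normalFormAutomaton.accepts ↔ HasForm IsNormal w := by
  -- Concatenation multiplies languages, hence is associative; bracketing to the right puts each
  -- generator automaton in front of all that follows it.
  have h : normalFormAutomaton.accepts = (concat (genAutomaton 1 3 (by norm_num))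
      (concat (genAutomaton 4 9 (by norm_num))
        (concat (genAutomaton 10 15 (by norm_num)) cliffordAutomaton))).accepts := by
    simp only [normalFormAutomaton, accepts_concat, mul_assoc]
  rw [h, mem_accepts_concat_genAutomaton _ _ _ _ _ (mem_accepts_concat_genAutomaton _ _ _ _ _
    (mem_accepts_concat_genAutomaton _ _ _ _ (fun l => l = []) fun w => ?_))]
  · simp only [HasForm, isNormal_iff]
  · rw [mem_accepts_cliffordAutomaton]
    constructor
    · rintro ⟨C, hC, h⟩
      exact ⟨[], rfl, C, hC, h⟩
    · rintro ⟨l, rfl, C, hC, h⟩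
      exact ⟨C, hC, h⟩

end CliffordCS

end

theorem mainTheorem2 :
    (∀ U ∈ CliffordCS.cliffordCS, ∀ a ∈ CliffordCS.normalForm U, a ∈ CliffordCS.alphabet) ∧
    ∀ w : List CliffordCS.alphabet,
      w ∈ CliffordCS.normalFormAutomaton.accepts ↔
        w.map Subtype.val ∈ CliffordCS.normalForms := by
  refine ⟨fun U hU a ha => CliffordCS.mem_alphabet_of_mem_normalForm hU ha, fun w => ?_⟩
  rw [CliffordCS.mem_accepts_normalFormAutomaton, CliffordCS.mem_normalForms_iff]
  rfl
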